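/- Let $a,b,m>0$ with $2m^2b/a^2>1$, and set $G(s)=-as^4+bs^6$, $W(s)=\tfrac12 m^2s^2+G(s)$, $V(s)=-2G(s)/s^2$ and $\omega_*=(m^2-\sup V)^{1/2}$. For $\omega\in(\omega_*,m)$ let $R_*(\omega)=\inf\{s>0: V(s)=m^2-\omega^2\}$ and let $R_\omega$ be the solution on $\mathbb{R}$ of $$R_\omega''=G'(R_\omega)+(m^2-\omega^2)R_\omega,\qquad R_\omega'(0)=0,\qquad R_\omega(0)=R_*(\omega).$$ Let $H^1_r$ be the space of even functions in $H^1(\mathbb{R};\mathbb{R})$, and on $H^1_r\times\mathbb{R}$ put $$E^*(u,\omega)=\tfrac12\int_{\mathbb{R}}\big(|u'|^2+\omega^2|u|^2+2W(u)\big)\,dx,\qquad C^*(u,\omega)=\omega\int_{\mathbb{R}}|u|^2\,dx,\qquad M^*_{\sigma,r}=\{(u,\omega)\in H^1_r\times\mathbb{R}: C^*(u,\omega)=\sigma\}.$$ For every $\omega\in(\omega_*,m)$ one has $R_\omega\in H^1_r$, and the charge map $\sigma(\omega)=\omega\|R_\omega\|_{L^2}^2$ is differentiable at $\omega$. Let $p$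 be one of the points $(R_\omega,\omega)$, $(-R_\omega,\omega)$, and suppose that $p$ minimizes $E^*$ on $M^*_{\sigma(\omega),r}$. Let $T_p=\ker dC^*(p)$ be the tangent space of $M^*_{\sigma(\omega),r}$ at $p$, and let $H(p)=D^2E^*(p)-\omega D^2C^*(p)$. Then the following are equivalent: 1. $p$ is non-degenerate, i.e. the null space of the bilinear form $H(p)$ restricted to $T_p$ is trivial; 2. $H(p)$ is positive definite on $T_p$, i.e. $H(p)[Y,Y]>0$ for every $Y\in T_p\setminus\{0\}$; 3. $\sigma'(\omega)\neq0$. -/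

import Mathlib

open MeasureTheory Set Filter Topology
open scoped ENNReal

noncomputable section

/-! ### The Sobolev space of the real line and its subspace of even functions -/

/-- `L²(ℝ; ℝ)`. -/
abbrev L2 : Type := Lp ℝ 2 (volume : Measure ℝ)

/-- `g` is the weak derivative of `u`. -/
def IsWeakDeriv (u g : L2) : Prop :=
  ∀ φ : ℝ → ℝ, ContDiff ℝ (⊤ : ℕ∞) φ → HasCompactSupport φ →
    ∫ x, u x * deriv φ x = - ∫ x, g x * φ x

theorem L2.integrable_mul (u : L2) {φ : ℝ → ℝ} (hφ : Continuous φ) (hc : HasCompactSupport φ) :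
    Integrable (fun x => u x * φ x) := by
  have h := ((Lp.memLp u).locallyIntegrable (by norm_num)).integrable_smul_right_of_hasCompactSupport
    hφ hc
  simpa [smul_eq_mul] using h

theorem L2.integral_add_mul (u v : L2) {φ : ℝ → ℝ} (hφ : Continuous φ)
    (hc : HasCompactSupport φ) :
    ∫ x, (u + v : L2) x * φ x = (∫ x, u x * φ x) + ∫ x, v x * φ x := by
  rw [← integral_add (L2.integrable_mul u hφ hc) (L2.integrable_mul v hφ hc)]
  refine integral_congr_ae ?_
  filter_upwards [Lp.coeFn_add u v] with x hx
  rw [hx, Pi.add_apply, add_mul]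

theorem L2.integral_smul_mul (c : ℝ) (u : L2) (φ : ℝ → ℝ) :
    ∫ x, (c • u : L2) x * φ x = c * ∫ x, u x * φ x := by
  rw [← integral_const_mul]
  refine integral_congr_ae ?_
  filter_upwards [Lp.coeFn_smul c u] with x hx
  rw [hx, Pi.smul_apply, smul_eq_mul, mul_assoc]

/-- The Hilbert space `H¹(ℝ; ℝ)`: the pairs `(u, u')` in `L² × L²` where `u'` is the weak
derivative of `u`, with the norm `(‖u‖² + ‖u'‖²)^(1/2)`. -/
def H1 : Submodule ℝ (WithLp 2 (L2 × L2)) where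
  carrier := {p | IsWeakDeriv p.fst p.snd}
  add_mem' := by
    intro p q hp hq φ hφ hc
    have hd : Continuous (deriv φ) := hφ.continuous_deriv (by simp)
    have h1 := L2.integral_add_mul p.fst q.fst hd hc.deriv
    have h2 := L2.integral_add_mul p.snd q.snd hφ.continuous hc
    change ∫ x, (p.fst + q.fst : L2) x * deriv φ x = - ∫ x, (p.snd + q.snd : L2) x * φ x
    rw [h1, h2, hp φ hφ hc, hq φ hφ hc]
    ring
  zero_mem' := by
    intro φ _ _
    change ∫ x, (0 : L2) x * deriv φ x = - ∫ x, (0 : L2) x * φ x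
    have h : ∀ ψ : ℝ → ℝ, ∫ x, (0 : L2) x * ψ x = 0 := by
      intro ψ
      simpa only [zero_smul, zero_mul] using L2.integral_smul_mul 0 0 ψ
    rw [h, h, neg_zero]
  smul_mem' := by
    intro c p hp φ hφ hc
    change ∫ x, (c • p.fst : L2) x * deriv φ x = - ∫ x, (c • p.snd : L2) x * φ x
    rw [L2.integral_smul_mul, L2.integral_smul_mul, hp φ hφ hc]
    ring

/-- The function underlying an element of `H¹`. -/
def H1val (u : H1) : L2 := (u : WithLp 2 (L2 × L2)).fst

/-- The weak derivative of an element of `H¹`. -/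
def H1grad (u : H1) : L2 := (u : WithLp 2 (L2 × L2)).snd

/-- `H¹_r(ℝ; ℝ)`: the even functions of `H¹`. -/
def H1r : Submodule ℝ H1 where
  carrier := {u | ∀ᵐ x : ℝ, H1val u (-x) = H1val u x}
  add_mem' := by
    intro u v hu hv
    have h := Lp.coeFn_add (H1val u) (H1val v)
    have h' := (Measure.measurePreserving_neg (volume : Measure ℝ)).quasiMeasurePreserving.ae h
    change ∀ᵐ x : ℝ, (H1val u + H1val v : L2) (-x) = (H1val u + H1val v : L2) x
    filter_upwards [h, h', hu, hv] with x h1 h2 h3 h4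
    rw [h1, h2, Pi.add_apply, Pi.add_apply, h3, h4]
  zero_mem' := by
    have h := Lp.coeFn_zero ℝ 2 (volume : Measure ℝ)
    have h' := (Measure.measurePreserving_neg (volume : Measure ℝ)).quasiMeasurePreserving.ae h
    change ∀ᵐ x : ℝ, (0 : L2) (-x) = (0 : L2) x
    filter_upwards [h, h'] with x h1 h2
    rw [h1, h2, Pi.zero_apply, Pi.zero_apply]
  smul_mem' := by
    intro c u hu
    have h := Lp.coeFn_smul c (H1val u)
    have h' := (Measure.measurePreserving_neg (volume : Measure ℝ)).quasiMeasurePreserving.ae h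
    change ∀ᵐ x : ℝ, (c • H1val u : L2) (-x) = (c • H1val u : L2) x
    filter_upwards [h, h', hu] with x h1 h2 h3
    rw [h1, h2, Pi.smul_apply, Pi.smul_apply, h3]

/-! ### Energy, charge and constraint -/

/-- The double power non-linearity. -/
def G (a b s : ℝ) : ℝ := -a * s ^ 4 + b * s ^ 6

/-- The potential `W(s) = m² |s|² / 2 + G(|s|)`. -/
def W (a b m s : ℝ) : ℝ := m ^ 2 * |s| ^ 2 / 2 + G a b |s|

/-- The energy `E*(u, ω)`. -/
def energy (a b m : ℝ) (p : H1 × ℝ) : ℝ :=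
  1 / 2 * ∫ x, (H1grad p.1 x ^ 2 + p.2 ^ 2 * H1val p.1 x ^ 2 + 2 * W a b m (H1val p.1 x))

/-- The charge `C*(u, ω)`. -/
def charge (p : H1 × ℝ) : ℝ := p.2 * ∫ x, H1val p.1 x ^ 2

/-- The energy on `H¹_r × ℝ`. -/
def energyR (a b m : ℝ) (p : H1r × ℝ) : ℝ := energy a b m ((p.1 : H1), p.2)

/-- The charge on `H¹_r × ℝ`. -/
def chargeR (p : H1r × ℝ) : ℝ := charge ((p.1 : H1), p.2)

/-- The radial constraint `M*_{σ,r}`. -/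
def constraintR (σ : ℝ) : Set (H1r × ℝ) := {p | chargeR p = σ}

/-- `p` is a (global) minimum of the energy on the radial constraint through `p`. -/
def IsRadialMinimum (a b m : ℝ) (p : H1r × ℝ) : Prop :=
  IsMinOn (energyR a b m) (constraintR (chargeR p)) p

/-! ### Tangent space, constrained Hessian, non-degeneracy -/

/-- The tangent space at `p` of the radial constraint through `p`: the kernel of the differential
of the charge. -/
def tangentSpaceR (p : H1r × ℝ) : Submodule ℝ (H1r × ℝ) :=
  (fderiv ℝ chargeR p).ker

/-- The Hessian `D²E* - ω D²C*` at `(u, ω)` of the energy as a constrained functional, where `ω` is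
the Lagrange multiplier. -/
def constrainedHessian (a b m : ℝ) (p : H1r × ℝ) (Y Z : H1r × ℝ) : ℝ :=
  fderiv ℝ (fderiv ℝ (energyR a b m)) p Y Z - p.2 * fderiv ℝ (fderiv ℝ chargeR) p Y Z

/-- The null space of the Hessian bilinear form restricted to the tangent space is trivial. -/
def IsNondegenerate (a b m : ℝ) (p : H1r × ℝ) : Prop :=
  ∀ Y ∈ tangentSpaceR p, (∀ Z ∈ tangentSpaceR p, constrainedHessian a b m p Y Z = 0) → Y = 0

/-- The Hessian bilinear form restricted to the tangent space is positive definite. -/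
def HasPosDefHessian (a b m : ℝ) (p : H1r × ℝ) : Prop :=
  ∀ Y ∈ tangentSpaceR p, Y ≠ 0 → 0 < constrainedHessian a b m p Y Y

/-! ### The standing-wave profiles -/

/-- `V(s) = -2 G(s) / s²`. -/
def V (a b s : ℝ) : ℝ := -(2 * G a b s) / s ^ 2

/-- `ω_* = (m² - sup V)^(1/2)`. -/
def omegaStar (a b m : ℝ) : ℝ := √(m ^ 2 - ⨆ s : ℝ, V a b s)

/-- `R_*(ω)`, the first positive solution `s` of `V(s) = m² - ω²`. -/
def Rstar (a b m ω : ℝ) : ℝ := sInf {s : ℝ | 0 < s ∧ V a b s = m ^ 2 - ω ^ 2}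

/-- `R` is a global classical solution of the initial value problem
`R'' = G'(R) + (m² - ω²) R`, `R'(0) = 0`, `R(0) = R_*(ω)`. -/
def SolvesIVP (a b m ω : ℝ) (R : ℝ → ℝ) : Prop :=
  ContDiff ℝ 2 R ∧
    (∀ x, deriv (deriv R) x = deriv (G a b) (R x) + (m ^ 2 - ω ^ 2) * R x) ∧
    deriv R 0 = 0 ∧ R 0 = Rstar a b m ω

theorem G_hasDerivAt (a b s : ℝ) : HasDerivAt (G a b) (-4 * a * s ^ 3 + 6 * b * s ^ 5) s := by
  have h := ((hasDerivAt_pow 4 s).const_mul (-a)).add ((hasDerivAt_pow 6 s).const_mul b)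
  refine h.congr_deriv ?_
  norm_num
  ring

theorem V_of_pos (a b s : ℝ) : V a b s = 2 * a * s ^ 2 - 2 * b * s ^ 4 := by
  unfold V G
  rcases eq_or_ne s 0 with h | h
  · simp [h]
  · field_simp
    ring

theorem iSup_V {a b : ℝ} (ha : 0 < a) (hb : 0 < b) : ⨆ s : ℝ, V a b s = a ^ 2 / (2 * b) := by
  have hle : ∀ s, V a b s ≤ a ^ 2 / (2 * b) := by
    intro s
    rw [V_of_pos, le_div_iff₀ (by positivity)]
    nlinarith [sq_nonneg (a - 2 * b * s ^ 2)]
  refine le_antisymm (ciSup_le hle) ?_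
  have h := le_ciSup (f := V a b) ⟨_, by rintro _ ⟨s, rfl⟩; exact hle s⟩ √(a / (2 * b))
  refine le_trans (le_of_eq ?_) h
  have h2 : √(a / (2 * b)) ^ 2 = a / (2 * b) := Real.sq_sqrt (by positivity)
  rw [V_of_pos, show √(a / (2 * b)) ^ 4 = (√(a / (2 * b)) ^ 2) ^ 2 by ring, h2]
  field_simp
  ring

theorem disc_pos {a b m ω : ℝ} (ha : 0 < a) (hb : 0 < b)
    (hω : ω ∈ Ioo (omegaStar a b m) m) :
    0 < m ^ 2 - ω ^ 2 ∧ 0 < a ^ 2 - 2 * b * (m ^ 2 - ω ^ 2) := by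
  obtain ⟨h1, h2⟩ := hω
  unfold omegaStar at h1
  rw [iSup_V ha hb] at h1
  have h0 : 0 < ω := lt_of_le_of_lt (Real.sqrt_nonneg _) h1
  have h3 := (Real.sqrt_lt' h0).1 h1
  refine ⟨by nlinarith, ?_⟩
  have h4 : m ^ 2 - ω ^ 2 < a ^ 2 / (2 * b) := by linarith
  rw [lt_div_iff₀ (by positivity)] at h4
  linarith

theorem Rstar_eq {a b m ω : ℝ} (ha : 0 < a) (hb : 0 < b)
    (hω : ω ∈ Ioo (omegaStar a b m) m) :
    Rstar a b m ω
      = 1 / √((a + √(a ^ 2 - 2 * b * (m ^ 2 - ω ^ 2))) / (m ^ 2 - ω ^ 2)) := by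
  obtain ⟨hk, hD⟩ := disc_pos ha hb hω
  unfold Rstar
  set k := m ^ 2 - ω ^ 2 with hkdef
  set D := √(a ^ 2 - 2 * b * k) with hDdef
  have hDpos : 0 < D := Real.sqrt_pos.2 hD
  have hDsq : D ^ 2 = a ^ 2 - 2 * b * k := Real.sq_sqrt hD.le
  have hyp : 0 < (a + D) / k := by positivity
  have hy2 : √((a + D) / k) ^ 2 = (a + D) / k := Real.sq_sqrt hyp.le
  have hypos : 0 < √((a + D) / k) := Real.sqrt_pos.2 hyp
  set r := 1 / √((a + D) / k) with hr
  have hrpos : 0 < r := by positivity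
  have hr2 : r ^ 2 = k / (a + D) := by
    rw [hr, div_pow, hy2]
    field_simp
  refine IsLeast.csInf_eq ⟨⟨hrpos, ?_⟩, ?_⟩
  · rw [V_of_pos, show r ^ 4 = (r ^ 2) ^ 2 by ring, hr2]
    have : a + D ≠ 0 := by positivity
    field_simp
    nlinarith
  · rintro s ⟨hs, hV⟩
    rw [V_of_pos] at hV
    refine (sq_le_sq₀ hrpos.le hs.le).1 ?_
    rw [hr2, div_le_iff₀ (by positivity)]
    by_contra hlt
    push Not at hlt
    have h1 : 0 < s ^ 2 := by positivity
    have h5 : k = s ^ 2 * (2 * a - 2 * b * s ^ 2) := by linarith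
    have h6 : a + D < 2 * a - 2 * b * s ^ 2 := by
      have := h5 ▸ hlt
      exact lt_of_mul_lt_mul_left this h1.le
    have h7 : (a - 2 * b * s ^ 2) ^ 2 = D ^ 2 := by rw [hDsq, h5]; ring
    have h8 : D < a - 2 * b * s ^ 2 := by linarith
    nlinarith

theorem exists_solvesIVP {a b m ω : ℝ} (ha : 0 < a) (hb : 0 < b)
    (hω : ω ∈ Ioo (omegaStar a b m) m) : ∃ R, SolvesIVP a b m ω R := by
  have hRs := Rstar_eq ha hb hω
  obtain ⟨hk, hD⟩ := disc_pos ha hb hω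
  unfold SolvesIVP
  rw [hRs]
  set k := m ^ 2 - ω ^ 2 with hkdef
  set D := √(a ^ 2 - 2 * b * k) with hDdef
  have hDpos : 0 < D := Real.sqrt_pos.2 hD
  have hDsq : D ^ 2 = a ^ 2 - 2 * b * k := Real.sq_sqrt hD.le
  set c := 2 * √k with hc
  have hcsq : c ^ 2 = 4 * k := by rw [hc, mul_pow, Real.sq_sqrt hk.le]; norm_num
  set y : ℝ → ℝ := fun x => (a + D * Real.cosh (c * x)) / k with hy
  set y' : ℝ → ℝ := fun x => (D * (Real.sinh (c * x) * c)) / k with hy'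
  have hypos : ∀ x, 0 < y x := fun x => by
    have := Real.cosh_pos (c * x)
    simp only [hy]; positivity
  have hlin : ∀ x, HasDerivAt (fun x : ℝ => c * x) c x := fun x => by
    simpa using (hasDerivAt_id x).const_mul c
  have hyd : ∀ x, HasDerivAt y (y' x) x := fun x =>
    (((hlin x).cosh.const_mul D).const_add a).div_const k
  have hy'd : ∀ x, HasDerivAt y' ((D * (Real.cosh (c * x) * c * c)) / k) x := fun x =>
    ((((hlin x).sinh.mul_const c).const_mul D)).div_const k
  set R : ℝ → ℝ := fun x => 1 / √(y x) with hR
  have hRpos : ∀ x, 0 < R x := fun x => by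
    have := Real.sqrt_pos.2 (hypos x)
    simp only [hR]; positivity
  have hRy : ∀ x, R x ^ 2 * y x = 1 := fun x => by
    have := (hypos x).ne'
    simp only [hR]; rw [div_pow, Real.sq_sqrt (hypos x).le]; field_simp
  have hRd : ∀ x, HasDerivAt R (-(1 / 2) * y' x * R x ^ 3) x := fun x => by
    have hs := Real.sqrt_pos.2 (hypos x)
    have h := ((hyd x).sqrt (hypos x).ne').inv hs.ne'
    have h' : HasDerivAt R (-(y' x / (2 * √(y x))) / √(y x) ^ 2) x := by
      have e : R = (fun x => √(y x))⁻¹ := by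
        funext z
        simp [hR]
      rw [e]
      exact h
    refine h'.congr_deriv ?_
    simp only [hR]
    field_simp
  have hRd1 : deriv R = fun x => -(1 / 2) * y' x * R x ^ 3 := funext fun x => (hRd x).deriv
  have hRsmooth : ContDiff ℝ 2 R := by
    have h1 : ContDiff ℝ 2 y := by
      simp only [hy]
      exact (contDiff_const.add (contDiff_const.mul
        ((contDiff_const.mul contDiff_id).cosh))).div_const k
    exact contDiff_const.div (h1.sqrt fun x => (hypos x).ne')
      fun x => (Real.sqrt_pos.2 (hypos x)).ne'
  refine ⟨R, hRsmooth, ?_, ?_, ?_⟩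
  · intro x
    rw [hRd1, (G_hasDerivAt a b _).deriv]
    have h := (((hy'd x).const_mul (-(1 / 2))).mul ((hRd x).pow 3))
    have h2 : HasDerivAt (fun x => -(1 / 2) * y' x * R x ^ 3) _ x := h
    rw [h2.deriv]
    have e1 : D * Real.cosh (c * x) = k * y x - a := by
      simp only [hy]; field_simp; ring
    have e2 : y' x ^ 2 = 4 * (k * y x ^ 2 - 2 * a * y x + 2 * b) := by
      have hsq := Real.cosh_sq (c * x)
      have : y' x ^ 2 = ((D * Real.cosh (c * x)) ^ 2 - D ^ 2) * c ^ 2 / k ^ 2 := by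
        simp only [hy', mul_pow]; rw [hsq]; field_simp; ring
      rw [this, e1, hDsq, hcsq]
      field_simp
      ring
    have e3 : D * (Real.cosh (c * x) * c * c) / k = 4 * (k * y x - a) := by
      rw [show D * (Real.cosh (c * x) * c * c) = (D * Real.cosh (c * x)) * c ^ 2 by ring, e1, hcsq]
      field_simp
    rw [e3]
    have hy1 := hRy x
    have key : 3 / 4 * y' x ^ 2 * R x ^ 5 - 1 / 2 * (4 * (k * y x - a)) * R x ^ 3
        = -4 * a * R x ^ 3 + 6 * b * R x ^ 5 + k * R x := by
      rw [e2]
      have t1 : R x ^ 5 * y x ^ 2 = R x := by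
        rw [show R x ^ 5 * y x ^ 2 = R x * (R x ^ 2 * y x) ^ 2 by ring, hy1]; ring
      have t2 : R x ^ 5 * y x = R x ^ 3 := by
        rw [show R x ^ 5 * y x = R x ^ 3 * (R x ^ 2 * y x) by ring, hy1]; ring
      have t3 : R x ^ 3 * y x = R x := by
        rw [show R x ^ 3 * y x = R x * (R x ^ 2 * y x) by ring, hy1]; ring
      linear_combination 3 * k * t1 - 6 * a * t2 - 2 * k * t3
    rw [← key]
    simp
    ring
  · rw [hRd1]; simp [hy']
  · simp [hR, hy]

theorem solvesIVP_unique {a b m ω : ℝ} {R S : ℝ → ℝ} (hR : SolvesIVP a b m ω R)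
    (hS : SolvesIVP a b m ω S) : R = S := by
  obtain ⟨hR1, hR2, hR3, hR4⟩ := hR
  obtain ⟨hS1, hS2, hS3, hS4⟩ := hS
  set v : ℝ × ℝ → ℝ × ℝ := fun p =>
    (p.2, -4 * a * p.1 ^ 3 + 6 * b * p.1 ^ 5 + (m ^ 2 - ω ^ 2) * p.1) with hv
  have hvs : ContDiff ℝ 1 v := by simp only [hv]; fun_prop
  have sol : ∀ Q : ℝ → ℝ, ContDiff ℝ 2 Q →
      (∀ x, deriv (deriv Q) x = deriv (G a b) (Q x) + (m ^ 2 - ω ^ 2) * Q x) →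
      ∀ x, HasDerivAt (fun x => (Q x, deriv Q x)) (v (Q x, deriv Q x)) x := by
    intro Q hQ hQ2 x
    have d1 : HasDerivAt Q (deriv Q x) x := (hQ.differentiable (by norm_num) x).hasDerivAt
    have hQ' : ContDiff ℝ 1 (deriv Q) := by
      have : ContDiff ℝ (1 + 1) Q := by norm_num; exact hQ
      exact (contDiff_succ_iff_deriv.1 this).2.2
    have d2 : HasDerivAt (deriv Q) (deriv (deriv Q) x) x :=
      (hQ'.differentiable (by norm_num) x).hasDerivAt
    rw [hQ2, (G_hasDerivAt a b _).deriv] at d2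
    exact d1.prodMk d2
  have hsR := sol R hR1 hR2
  have hsS := sol S hS1 hS2
  have cR : Continuous fun x => (R x, deriv R x) :=
    continuous_iff_continuousAt.2 fun x => (hsR x).continuousAt
  have cS : Continuous fun x => (S x, deriv S x) :=
    continuous_iff_continuousAt.2 fun x => (hsS x).continuousAt
  have h : (fun x => (R x, deriv R x)) = fun x => (S x, deriv S x) := by
    funext x
    obtain ⟨N, hN⟩ := exists_gt |x|
    have hN0 : 0 < N := lt_of_le_of_lt (abs_nonneg x) hN
    obtain ⟨B, hB⟩ := (isCompact_Icc (a := -N) (b := N)).exists_bound_of_continuousOn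
      cR.continuousOn
    obtain ⟨B', hB'⟩ := (isCompact_Icc (a := -N) (b := N)).exists_bound_of_continuousOn
      cS.continuousOn
    obtain ⟨K, hK⟩ := hvs.contDiffOn.exists_lipschitzOnWith (s := Metric.closedBall 0 (max B B'))
      (by norm_num) (convex_closedBall _ _) (isCompact_closedBall _ _)
    have hmem := ODE_solution_unique_of_mem_Ioo (v := fun _ => v)
      (s := fun _ => Metric.closedBall 0 (max B B')) (K := K) (a := -N) (b := N) (t₀ := 0)
      (fun _ _ => hK) (by simp [hN0])
      (fun t ht => ⟨hsR t, by
        simpa using Or.inl (hB t (Ioo_subset_Icc_self ht))⟩)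
      (fun t ht => ⟨hsS t, by
        simpa using Or.inr (hB' t (Ioo_subset_Icc_self ht))⟩)
      (by simp [hR3, hS3, hR4, hS4])
    exact hmem (abs_lt.1 hN)
  funext x
  exact congrArg Prod.fst (congrFun h x)

open Classical in
/-- The profile `R_ω`: the solution of the initial value problem, which exists and is unique for
`ω` in `(ω_*, m)`. -/
def profile (a b m ω : ℝ) : ℝ → ℝ :=
  if h : ∃ R, SolvesIVP a b m ω R then h.choose else 0

theorem profile_spec {a b m ω : ℝ} (ha : 0 < a) (hb : 0 < b)
    (hω : ω ∈ Ioo (omegaStar a b m) m) : SolvesIVP a b m ω (profile a b m ω) := by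
  have h := exists_solvesIVP ha hb hω
  unfold profile
  rw [dif_pos h]
  exact h.choose_spec

/-- The charge map `σ(ω) = ω ‖R_ω‖²`. -/
def chargeMap (a b m ω : ℝ) : ℝ := ω * ∫ x, profile a b m ω x ^ 2

end

noncomputable section

/-! Write `E* = F(u) + ½ω²N(u)` and `C* = ωN(u)`, where `N` is the squared `L²` norm. Put `n =
N(u)`, `ℓ = dN(u)` and `A = D²F(u) - ½ω²D²N(u)`. In `D²E* - ωD²C*` the mixed terms cancel
(`hessian_form`), so `H[(v,α),(w,β)] = A(v,w) + αβn`. The tangent space is the graph `α = -ωℓ(v)/n`,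
on which `H` becomes `Q(v,w) = A(v,w) + ω²ℓ(v)ℓ(w)/n`.

`Q` is also the second variation of `F + σ²/(2N)`, the energy after eliminating the frequency
through the constraint, so a minimum has `Q ≥ 0` (`reduced_hessian_nonneg`). A nonnegative symmetric
form vanishes on the diagonal only at vectors of its null space. This gives the equivalence of
non-degeneracy and positive definiteness.

It remains to decide when `Q`, a rank-one perturbation of `A`, has a null vector. `A` is the form of
the Schrödinger operator `-d²/dx² + q` with `q = G''(R_ω) + m² - ω²`. The odd function `R_ω'` solves
`v'' = qv` and is square-integrable. Its Wronskian with an even `H¹` solution is constant and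
integrable, hence zero, so the even solution vanishes (`even_kernel_trivial`). Differentiating the
profile equation in `ω` shows that `S = ∂_ω R_ω` satisfies `A S = ωℓ` (up to the sign of `p`).
Linear algebra (`reduced_form_nondegenerate_iff`) then says that `Q` has a null vector exactly when
`n + ωℓ(S) = 0`, and `n + ωℓ(S)` is the derivative of `ωN(R_ω)`, that is `σ'(ω)`.

The analysis of the profile is explicit. With `k = m² - ω²` and `D = √(a² - 2bk)`, the function `y =
R_ω⁻²` is `(a + D cosh(2√k x))/k`. Regularity, exponential decay, the dependence on `k` and both
differential equations are read off from this formula. -/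

/-! ### Weak derivatives on the line: continuous representatives, integration by parts, sup bound.
-/

theorem intervalIntegrable_of_locallyIntegrable {g : ℝ → ℝ} (hg : LocallyIntegrable g) (s t : ℝ) :
    IntervalIntegrable g volume s t :=
  (hg.integrableOn_isCompact isCompact_uIcc).intervalIntegrable

/-- Both primitives are absolutely continuous, with derivatives `g` and `h` almost everywhere, so
this is the product rule integrated. The interval must contain `0` because the primitives are based
there. -/
theorem primitive_mul_sub_primitive_mul {g h : ℝ → ℝ} (hg : LocallyIntegrable g)
    (hh : LocallyIntegrable h) (c d : ℝ) {α β : ℝ} (hα : α ≤ 0) (hβ : 0 ≤ β) :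
    ∫ x in α..β, (g x * (d + ∫ t in (0 : ℝ)..x, h t) + (c + ∫ t in (0 : ℝ)..x, g t) * h x) =
      (c + ∫ t in (0 : ℝ)..β, g t) * (d + ∫ t in (0 : ℝ)..β, h t) -
        (c + ∫ t in (0 : ℝ)..α, g t) * (d + ∫ t in (0 : ℝ)..α, h t) := by
  have hac : ∀ (f : ℝ → ℝ) (e : ℝ), LocallyIntegrable f →
      AbsolutelyContinuousOnInterval (fun x => e + ∫ t in (0 : ℝ)..x, f t) α β := by
    intro f e hf
    have h1 : AbsolutelyContinuousOnInterval (fun _ : ℝ => e) α β :=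
      (contDiff_const.contDiffOn).absolutelyContinuousOnInterval
    refine h1.add ((intervalIntegrable_of_locallyIntegrable hf α β).absolutelyContinuousOnInterval_intervalIntegral ?_)
    rw [uIcc_of_le (hα.trans hβ)]
    exact ⟨hα, hβ⟩
  rw [← (hac g c hg).integral_deriv_mul_eq_sub (hac h d hh)]
  refine intervalIntegral.integral_congr_ae ?_
  filter_upwards [LocallyIntegrable.ae_hasDerivAt_integral hg,
    LocallyIntegrable.ae_hasDerivAt_integral hh] with x h1 h2 _
  rw [((h1 0).const_add c).deriv, ((h2 0).const_add d).deriv]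

theorem continuous_primitive_of_locallyIntegrable {g : ℝ → ℝ} (hg : LocallyIntegrable g) (c : ℝ) :
    Continuous fun x => c + ∫ t in (0 : ℝ)..x, g t :=
  continuous_const.add (intervalIntegral.continuous_primitive 
    (intervalIntegrable_of_locallyIntegrable hg) 0)

theorem L2.locallyIntegrable (u : L2) : LocallyIntegrable u :=
  (Lp.memLp u).locallyIntegrable (by norm_num)

theorem exists_Ioc_support_subset {φ : ℝ → ℝ} (hc : HasCompactSupport φ) :
    ∃ N : ℝ, 0 < N ∧ ∀ x, x ∉ Ioo (-N) N → φ x = 0 := by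
  obtain ⟨r, hr⟩ := hc.isCompact.isBounded.subset_ball (0 : ℝ)
  refine ⟨max r 1, by positivity, fun x hx => ?_⟩
  by_contra h
  have h1 := hr (subset_tsupport _ h)
  rw [Metric.mem_ball, dist_zero_right, Real.norm_eq_abs, abs_lt] at h1
  exact hx ⟨by linarith [le_max_left r 1], by linarith [le_max_left r 1]⟩

/-- Integration by parts of a primitive against a compactly supported function. -/
theorem integral_primitive_mul_deriv {g : ℝ → ℝ} (hg : LocallyIntegrable g) (c : ℝ) {φ : ℝ → ℝ}
    (hφ : ContDiff ℝ 1 φ) (hc : HasCompactSupport φ) :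
    ∫ x, (c + ∫ t in (0 : ℝ)..x, g t) * deriv φ x = - ∫ x, g x * φ x := by
  obtain ⟨N, hN, hz⟩ := exists_Ioc_support_subset hc
  obtain ⟨N', hN', hz'⟩ := exists_Ioc_support_subset hc.deriv
  set M := max N N'
  have hdc : Continuous (deriv φ) := hφ.continuous_deriv le_rfl
  have hprim : ∀ x, φ x = φ 0 + ∫ t in (0 : ℝ)..x, deriv φ t := by
    intro x
    rw [intervalIntegral.integral_deriv_eq_sub
      (fun y _ => hφ.differentiable (by norm_num) y) (hdc.intervalIntegrable _ _)]
    ring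
  have hM : 0 < M := lt_max_of_lt_left hN
  -- `φ` is itself a primitive, of `deriv φ` with constant `φ 0`; the boundary terms vanish outside
  -- its support.
  have h := primitive_mul_sub_primitive_mul hg hdc.locallyIntegrable c (φ 0)
    (neg_nonpos.2 hM.le) hM.le
  simp only [← hprim] at h
  rw [hz M (fun h => by linarith [h.2, le_max_left N N']),
    hz (-M) (fun h => by linarith [h.1, le_max_left N N']), mul_zero, mul_zero, sub_zero] at h
  have hcont := continuous_primitive_of_locallyIntegrable hg c
  have i1 : Integrable fun x => g x * φ x := by
    simpa [smul_eq_mul] using hg.integrable_smul_right_of_hasCompactSupport hφ.continuous hc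
  have i2 : Integrable fun x => (c + ∫ t in (0 : ℝ)..x, g t) * deriv φ x :=
    (hcont.mul hdc).integrable_of_hasCompactSupport hc.deriv.mul_left
  rw [intervalIntegral.integral_eq_integral_of_support_subset, integral_add i1 i2] at h
  · linarith
  · intro x hx
    by_contra hx'
    refine hx ?_
    have hm : ∀ K, K ≤ M → x ∉ Ioo (-K) K := fun K hK h =>
      hx' ⟨by linarith [h.1], by linarith [h.2]⟩
    simp only [hz x (hm _ (le_max_left _ _)), hz' x (hm _ (le_max_right _ _)), mul_zero, add_zero]

/-- A locally integrable function whose integral vanishes against all derivatives of test functions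
is constant. -/
theorem ae_eq_const_of_integral_mul_deriv_eq_zero {f : ℝ → ℝ} (hf : LocallyIntegrable f)
    (h : ∀ φ : ℝ → ℝ, ContDiff ℝ (⊤ : ℕ∞) φ → HasCompactSupport φ → ∫ x, f x * deriv φ x = 0) :
    ∃ c : ℝ, ∀ᵐ x, f x = c := by
  let β : ContDiffBump (0 : ℝ) := ⟨1, 2, by norm_num, by norm_num⟩
  have hβi : 0 < ∫ x, β x := β.integral_pos
  set I := ∫ x, β x
  refine ⟨(∫ x, f x * β x) / I, ?_⟩
  set c := (∫ x, f x * β x) / I with hcdef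
  have hβs : ContDiff ℝ (⊤ : ℕ∞) β := β.contDiff
  have hβc : HasCompactSupport β := β.hasCompactSupport
  have hmul : ∀ ψ : ℝ → ℝ, Continuous ψ → HasCompactSupport ψ →
      Integrable fun x => f x * ψ x := fun ψ h1 h2 => by
    simpa [smul_eq_mul] using hf.integrable_smul_right_of_hasCompactSupport h1 h2
  have hfc : LocallyIntegrable fun x => f x - c := hf.sub (locallyIntegrable_const c)
  have key := ae_eq_zero_of_integral_contDiff_smul_eq_zero hfc ?_
  · filter_upwards [key] with x hx
    linarith
  intro ψ hψ hψc
  have hψi : Integrable ψ := hψ.continuous.integrable_of_hasCompactSupport hψc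
  have hβint : Integrable β := hβs.continuous.integrable_of_hasCompactSupport hβc
  set J := ∫ x, ψ x
  -- Removing a multiple of the bump makes the mean zero, so the primitive of `η` from `-N` is again
  -- compactly supported and `η` is the derivative of a test function.
  set η : ℝ → ℝ := fun x => ψ x - J / I * β x with hη
  have hηs : ContDiff ℝ (⊤ : ℕ∞) η := hψ.sub (contDiff_const.mul hβs)
  have hηc : HasCompactSupport η := hψc.sub (hβc.mul_left)
  have hη0 : ∫ x, η x = 0 := by
    rw [integral_sub hψi (hβint.const_mul _), integral_const_mul]
    change J - J / I * I = 0
    field_simp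
    ring
  obtain ⟨N, hN, hz⟩ := exists_Ioc_support_subset hηc
  set φ : ℝ → ℝ := fun x => ∫ t in (-N)..x, η t with hφ
  have hφd : ∀ x, HasDerivAt φ (η x) x := fun x =>
    intervalIntegral.integral_hasDerivAt_right (hηs.continuous.intervalIntegrable _ _)
      (hηs.continuous.stronglyMeasurableAtFilter _ _) hηs.continuous.continuousAt
  have hφ' : deriv φ = η := funext fun x => (hφd x).deriv
  have hφs : ContDiff ℝ (⊤ : ℕ∞) φ := by
    rw [contDiff_infty_iff_deriv, hφ']
    exact ⟨fun x => (hφd x).differentiableAt, hηs⟩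
  have hφc : HasCompactSupport φ := by
    refine HasCompactSupport.intro (isCompact_Icc (a := -N) (b := N)) fun x hx => ?_
    rcases lt_or_ge x (-N) with h1 | h1
    · simp only [hφ]
      rw [intervalIntegral.integral_symm, neg_eq_zero]
      refine intervalIntegral.integral_zero_ae (Eventually.of_forall fun t ht => hz t ?_)
      rw [uIoc_of_le h1.le] at ht
      exact fun h => by linarith [h.1, ht.2]
    · have h2 : N < x := by
        by_contra h3
        exact hx ⟨h1, not_lt.1 h3⟩
      simp only [hφ]
      rw [intervalIntegral.integral_eq_integral_of_support_subset, hη0]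
      intro t ht
      by_contra h3
      exact ht (hz t fun h4 => h3 ⟨h4.1, h4.2.le.trans h2.le⟩)
  have h0 := h φ hφs hφc
  rw [hφ'] at h0
  have e1 : ∫ x, f x * η x = (∫ x, f x * ψ x) - J / I * ∫ x, f x * β x := by
    rw [← integral_const_mul, ← integral_sub (hmul ψ hψ.continuous hψc)
      ((hmul β hβs.continuous hβc).const_mul _)]
    exact integral_congr_ae (Eventually.of_forall fun x => by simp only [hη]; ring)
  have e2 : ∫ x, ψ x • (f x - c) = (∫ x, f x * ψ x) - c * J := by
    rw [← integral_const_mul, ← integral_sub (hmul ψ hψ.continuous hψc) (hψi.const_mul _)]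
    exact integral_congr_ae (Eventually.of_forall fun x => by simp only [smul_eq_mul]; ring)
  rw [e2, hcdef]
  rw [e1] at h0
  refine Eq.trans ?_ h0
  ring

namespace IsWeakDeriv

variable {u g v h : L2}

/-- The difference between `u` and a primitive of `g` has zero weak derivative, hence is constant.
This supplies the continuous representative used in all pointwise arguments. -/
theorem exists_ae_eq_primitive (hu : IsWeakDeriv u g) :
    ∃ c : ℝ, ∀ᵐ x, u x = c + ∫ t in (0 : ℝ)..x, g t := by
  have hg := g.locallyIntegrable
  have hcont := continuous_primitive_of_locallyIntegrable hg 0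
  obtain ⟨c, hc⟩ := ae_eq_const_of_integral_mul_deriv_eq_zero
    (f := fun x => u x - (0 + ∫ t in (0 : ℝ)..x, g t))
    (u.locallyIntegrable.sub (hcont.locallyIntegrable (μ := volume))) (fun φ hφ hφc => by
      have hd : Continuous (deriv φ) := hφ.continuous_deriv (by simp)
      have e := integral_primitive_mul_deriv hg 0 (hφ.of_le (by simp)) hφc
      have i2 : Integrable fun x => (0 + ∫ t in (0 : ℝ)..x, g t) * deriv φ x :=
        (hcont.mul hd).integrable_of_hasCompactSupport hφc.deriv.mul_left
      simp only [sub_mul]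
      rw [integral_sub (L2.integrable_mul u hd hφc.deriv) i2, hu φ hφ hφc]
      exact sub_eq_zero.2 e.symm)
  refine ⟨c, ?_⟩
  filter_upwards [hc] with x hx
  linarith

/-- Integration by parts in `H¹`. -/
theorem integral_mul_eq_neg (hu : IsWeakDeriv u g) (hv : IsWeakDeriv v h) :
    ∫ x, u x * h x = - ∫ x, g x * v x := by
  obtain ⟨c, hc⟩ := hu.exists_ae_eq_primitive
  obtain ⟨d, hd⟩ := hv.exists_ae_eq_primitive
  set U : ℝ → ℝ := fun x => c + ∫ t in (0 : ℝ)..x, g t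
  set P : ℝ → ℝ := fun x => d + ∫ t in (0 : ℝ)..x, h t
  have hU : Continuous U := continuous_primitive_of_locallyIntegrable g.locallyIntegrable c
  have hP : Continuous P := continuous_primitive_of_locallyIntegrable h.locallyIntegrable d
  have i1 : Integrable fun x => u x * h x := (Lp.memLp u).integrable_mul (Lp.memLp h)
  have i2 : Integrable fun x => g x * v x := (Lp.memLp g).integrable_mul (Lp.memLp v)
  have i3 : Integrable fun x => U x * P x := by
    refine ((Lp.memLp u).integrable_mul (Lp.memLp v)).congr ?_
    filter_upwards [hc, hd] with x h1 h2
    rw [Pi.mul_apply, h1, h2]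
  have hF : ∀ α β : ℝ, α ≤ 0 → 0 ≤ β →
      ∫ x in α..β, (g x * v x + u x * h x) = U β * P β - U α * P α := by
    intro α β hα hβ
    rw [← primitive_mul_sub_primitive_mul g.locallyIntegrable h.locallyIntegrable c d hα hβ]
    refine intervalIntegral.integral_congr_ae ?_
    filter_upwards [hc, hd] with x h1 h2 _
    rw [h1, h2]
  have i4 := i2.add i1
  -- The derivative of `U P` is integrable, so `U P` has limits at both ends.
  have lim1 : Tendsto (fun β => U β * P β) atTop
      (𝓝 ((∫ x in Ioi 0, (g x * v x + u x * h x)) + U 0 * P 0)) := by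
    have := (intervalIntegral_tendsto_integral_Ioi 0 i4.integrableOn tendsto_id).add_const
      (U 0 * P 0)
    refine this.congr' ?_
    filter_upwards [eventually_ge_atTop (0 : ℝ)] with β hβ
    have := hF 0 β le_rfl hβ
    simp only [Pi.add_apply, id]
    linarith
  have lim2 : Tendsto (fun α => U α * P α) atBot
      (𝓝 (U 0 * P 0 - (∫ x in Iic 0, (g x * v x + u x * h x)))) := by
    have := (intervalIntegral_tendsto_integral_Iic 0 i4.integrableOn tendsto_id).const_sub
      (U 0 * P 0)
    refine this.congr' ?_
    filter_upwards [eventually_le_atBot (0 : ℝ)] with α hα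
    have := hF α 0 hα le_rfl
    simp only [Pi.add_apply, id]
    linarith
  -- `U P` is integrable and neighbourhoods of infinity have infinite measure, so the limits can
  -- only be zero.
  have z1 := IntegrableAtFilter.eq_zero_of_tendsto (i3.integrableAtFilter atTop) (fun s hs => by
    obtain ⟨b, hb⟩ := mem_atTop_sets.1 hs
    rw [← top_le_iff, ← Real.volume_Ici (a := b)]
    exact measure_mono hb) lim1
  have z2 := IntegrableAtFilter.eq_zero_of_tendsto (i3.integrableAtFilter atBot) (fun s hs => by
    obtain ⟨b, hb⟩ := mem_atBot_sets.1 hs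
    rw [← top_le_iff, ← Real.volume_Iic (a := b)]
    exact measure_mono hb) lim2
  have e := intervalIntegral.integral_Iic_add_Ioi (b := (0 : ℝ)) i4.integrableOn i4.integrableOn
  simp only [Pi.add_apply] at e
  rw [integral_add i2 i1] at e
  linarith

/-- For `y` in `[x, x + 1]` one has `|U x| ≤ |U y| + ‖g‖`; averaging over `y` gives the bound. -/
theorem ae_abs_le (hu : IsWeakDeriv u g) : ∀ᵐ x, |u x| ≤ ‖u‖ + ‖g‖ := by
  obtain ⟨c, hc⟩ := hu.exists_ae_eq_primitive
  set U : ℝ → ℝ := fun x => c + ∫ t in (0 : ℝ)..x, g t with hUdef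
  have hU : Continuous U := continuous_primitive_of_locallyIntegrable g.locallyIntegrable c
  have hL : ∀ (f : L2) (x : ℝ), ∫ t in x..(x + 1), |f t| ≤ ‖f‖ := by
    intro f x
    rw [intervalIntegral.integral_of_le (by linarith)]
    -- On an interval of length one the `L¹` norm is at most the `L²` norm, with constant `1`.
    have : IsProbabilityMeasure (volume.restrict (Ioc x (x + 1))) := ⟨by simp⟩
    have hf := (Lp.memLp f).restrict (Ioc x (x + 1))
    have hf1 : MemLp f 1 (volume.restrict (Ioc x (x + 1))) := hf.mono_exponent (by norm_num)
    have e : ∫ t in Ioc x (x + 1), |f t| =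
        (eLpNorm f 1 (volume.restrict (Ioc x (x + 1)))).toReal := by
      rw [eLpNorm_one_eq_lintegral_enorm, integral_eq_lintegral_of_nonneg_ae
        (Eventually.of_forall fun t => abs_nonneg _) hf.1.norm]
      congr 1
      refine lintegral_congr fun t => ?_
      rw [← Real.norm_eq_abs, ofReal_norm]
    rw [e, Lp.norm_def]
    refine ENNReal.toReal_mono (Lp.eLpNorm_ne_top f) ?_
    exact (eLpNorm_le_eLpNorm_of_exponent_le (by norm_num) hf.1).trans
      (eLpNorm_mono_measure _ Measure.restrict_le_self)
  filter_upwards [hc] with x hx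
  rw [hx]
  change |U x| ≤ _
  have gi : ∀ s t, IntervalIntegrable g volume s t := 
    intervalIntegrable_of_locallyIntegrable g.locallyIntegrable
  have hle : ∀ y ∈ Icc x (x + 1), |U x| ≤ |U y| + ‖g‖ := by
    intro y hy
    have e : U y - U x = ∫ t in x..y, g t := by
      simp only [hUdef]
      rw [← intervalIntegral.integral_add_adjacent_intervals (gi 0 x) (gi x y)]
      ring
    have h1 : |∫ t in x..y, g t| ≤ ∫ t in x..y, |g t| :=
      intervalIntegral.abs_integral_le_integral_abs hy.1
    have h2 : ∫ t in x..y, |g t| ≤ ∫ t in x..(x + 1), |g t| :=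
      intervalIntegral.integral_mono_interval le_rfl hy.1 hy.2
        (Eventually.of_forall fun t => abs_nonneg _) (gi _ _).abs
    rw [← e] at h1
    have h3 := abs_sub_abs_le_abs_sub (U x) (U y)
    rw [abs_sub_comm] at h3
    linarith [hL g x]
  have h4 : ∫ y in x..(x + 1), |U x| ≤ ∫ y in x..(x + 1), (|U y| + ‖g‖) :=
    intervalIntegral.integral_mono_on (by linarith) (by simp)
      ((hU.abs.add continuous_const).intervalIntegrable _ _) hle
  rw [intervalIntegral.integral_add (hU.abs.intervalIntegrable _ _) (by simp)] at h4
  simp only [intervalIntegral.integral_const, add_sub_cancel_left, one_smul] at h4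
  have h5 : ∫ y in x..(x + 1), |U y| = ∫ y in x..(x + 1), |u y| := by
    refine intervalIntegral.integral_congr_ae ?_
    filter_upwards [hc] with y hy _
    rw [hy]
  linarith [hL u x]

end IsWeakDeriv

theorem isWeakDeriv_toLp {f f' : ℝ → ℝ} (hd : ∀ x, HasDerivAt f (f' x) x) (hf : MemLp f 2)
    (hf' : MemLp f' 2) : IsWeakDeriv (hf.toLp f) (hf'.toLp f') := by
  intro φ hφ hc
  have hcf : Continuous f := continuous_iff_continuousAt.2 fun x => (hd x).continuousAt
  have hdc : Continuous (deriv φ) := hφ.continuous_deriv (by simp)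
  have e1 : ∫ x, hf.toLp f x * deriv φ x = ∫ x, f x * deriv φ x := by
    refine integral_congr_ae ?_
    filter_upwards [hf.coeFn_toLp] with x hx
    rw [hx]
  have e2 : ∫ x, hf'.toLp f' x * φ x = ∫ x, f' x * φ x := by
    refine integral_congr_ae ?_
    filter_upwards [hf'.coeFn_toLp] with x hx
    rw [hx]
  rw [e1, e2]
  refine integral_mul_deriv_eq_deriv_mul_of_integrable (fun x _ => hd x)
    (fun x _ => (hφ.differentiable (by simp) x).hasDerivAt) ?_ ?_ ?_
  · exact (hcf.mul hdc).integrable_of_hasCompactSupport hc.deriv.mul_left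
  · have := (hf'.locallyIntegrable (by norm_num)).integrable_smul_right_of_hasCompactSupport
      hφ.continuous hc
    simp only [smul_eq_mul] at this
    exact this
  · exact (hcf.mul hφ.continuous).integrable_of_hasCompactSupport hc.mul_left

/-! ### Second-order conditions and the Hessian for energies `F(u) + ½ω²N(u)` and charges `ωN(u)`.
-/

/-- The second-order necessary condition for a local minimum on the line. -/
theorem IsLocalMin.second_deriv_nonneg {j j' : ℝ → ℝ} {j'' x : ℝ} (hmin : IsLocalMin j x)
    (h1 : ∀ᶠ t in 𝓝 x, HasDerivAt j (j' t) t) (h2 : HasDerivAt j' j'' x) : 0 ≤ j'' := by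
  by_contra hneg
  push Not at hneg
  have e1 : deriv j =ᶠ[𝓝 x] j' := h1.mono fun t ht => ht.deriv
  have e2 : deriv (deriv j) x = j'' := by rw [e1.deriv_eq, h2.deriv]
  -- A negative second derivative makes `x` a local maximum too, so `j` is locally constant and its
  -- second derivative is zero after all.
  have hmax : IsLocalMax j x := isLocalMax_of_deriv_deriv_neg (by rw [e2]; exact hneg)
    hmin.deriv_eq_zero h1.self_of_nhds.continuousAt
  have hc : j =ᶠ[𝓝 x] fun _ => j x := by
    filter_upwards [hmin, hmax] with t a b using le_antisymm b a
  have e3 : deriv j =ᶠ[𝓝 x] fun _ => 0 := by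
    filter_upwards [hc.eventuallyEq_nhds] with t ht
    rw [ht.deriv_eq, deriv_const]
  rw [e3.deriv_eq, deriv_const] at e2
  exact hneg.ne e2.symm

section Constrained

variable {X : Type*} [NormedAddCommGroup X] [NormedSpace ℝ X] {F N : X → ℝ}

theorem hasDerivAt_comp_line {Y : Type*} [NormedAddCommGroup Y] [NormedSpace ℝ Y] {f : X → Y}
    {f' : X →L[ℝ] Y} {u v : X} {t : ℝ} (hf : HasFDerivAt f f' (u + t • v)) :
    HasDerivAt (fun s : ℝ => f (u + s • v)) (f' v) t := by
  have h : HasDerivAt (fun s : ℝ => u + s • v) v t := by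
    simpa using ((hasDerivAt_id t).smul_const v).const_add u
  exact hf.comp_hasDerivAt t h

theorem hasFDerivAt_mul_charge (hN : Differentiable ℝ N) (p : X × ℝ) :
    HasFDerivAt (fun p : X × ℝ => p.2 * N p.1)
      (p.2 • (fderiv ℝ N p.1).comp (ContinuousLinearMap.fst ℝ X ℝ) +
        N p.1 • ContinuousLinearMap.snd ℝ X ℝ) p :=
  hasFDerivAt_snd.mul ((hN p.1).hasFDerivAt.comp p hasFDerivAt_fst)

theorem hasFDerivAt_energy_form (hF : Differentiable ℝ F) (hN : Differentiable ℝ N) (p : X × ℝ) :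
    HasFDerivAt (fun p : X × ℝ => F p.1 + 1 / 2 * p.2 ^ 2 * N p.1)
      ((fderiv ℝ F p.1).comp (ContinuousLinearMap.fst ℝ X ℝ) +
        ((1 / 2 * p.2 ^ 2) • (fderiv ℝ N p.1).comp (ContinuousLinearMap.fst ℝ X ℝ) +
        N p.1 • (p.2 • ContinuousLinearMap.snd ℝ X ℝ))) p := by
  have h1 : HasFDerivAt (fun p : X × ℝ => 1 / 2 * p.2 ^ 2)
      (p.2 • ContinuousLinearMap.snd ℝ X ℝ) p := by
    have h := ((hasFDerivAt_snd (𝕜 := ℝ) (p := p)).pow 2).const_mul (1 / 2 : ℝ)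
    refine h.congr_fderiv ?_
    ext x <;> simp
  exact ((hF p.1).hasFDerivAt.comp p hasFDerivAt_fst).add
    (h1.mul ((hN p.1).hasFDerivAt.comp p hasFDerivAt_fst))

theorem fderiv_charge_form (hN : Differentiable ℝ N) (u v : X) (ω α : ℝ) :
    fderiv ℝ (fun p : X × ℝ => p.2 * N p.1) (u, ω) (v, α) = ω * fderiv ℝ N u v + α * N u := by
  rw [(hasFDerivAt_mul_charge hN (u, ω)).fderiv]
  simp [mul_comm]

theorem fderiv_energy_form (hF : Differentiable ℝ F) (hN : Differentiable ℝ N) (u v : X)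
    (ω α : ℝ) :
    fderiv ℝ (fun p : X × ℝ => F p.1 + 1 / 2 * p.2 ^ 2 * N p.1) (u, ω) (v, α) =
      fderiv ℝ F u v + (1 / 2 * ω ^ 2 * fderiv ℝ N u v + ω * α * N u) := by
  rw [(hasFDerivAt_energy_form hF hN (u, ω)).fderiv]
  simp
  ring

/-- Once `C²` regularity is known abstractly, second derivatives can be computed one variable at a
time along lines; every Hessian formula below is obtained this way. -/
theorem fderiv_fderiv_eq_of_hasDerivAt {Z : Type*} [NormedAddCommGroup Z] [NormedSpace ℝ Z]
    {f : Z → ℝ} (hf : ContDiff ℝ 2 f) {p y z : Z} {d : ℝ}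
    (h : HasDerivAt (fun s : ℝ => fderiv ℝ f (p + s • y) z) d 0) :
    fderiv ℝ (fderiv ℝ f) p y z = d := by
  have h1 : ContDiff ℝ 1 (fderiv ℝ f) := hf.fderiv_right (by norm_num)
  have h2 : HasFDerivAt (fderiv ℝ f) (fderiv ℝ (fderiv ℝ f) p) (p + (0 : ℝ) • y) := by
    rw [zero_smul, add_zero]
    exact (h1.differentiable (by norm_num) p).hasFDerivAt
  have h3 := (hasDerivAt_comp_line h2).clm_apply (hasDerivAt_const 0 z)
  have h4 := h3.unique h
  simpa using h4

theorem hasDerivAt_fderiv_line (hF : ContDiff ℝ 2 F) (u v w : X) :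
    HasDerivAt (fun s : ℝ => fderiv ℝ F (u + s • v) w) (fderiv ℝ (fderiv ℝ F) u v w) 0 := by
  have h1 : ContDiff ℝ 1 (fderiv ℝ F) := hF.fderiv_right (by norm_num)
  have h2 : HasFDerivAt (fderiv ℝ F) (fderiv ℝ (fderiv ℝ F) u) (u + (0 : ℝ) • v) := by
    rw [zero_smul, add_zero]
    exact (h1.differentiable (by norm_num) u).hasFDerivAt
  have h3 := (hasDerivAt_comp_line h2).clm_apply (hasDerivAt_const 0 w)
  simpa using h3

theorem hasDerivAt_line (hF : Differentiable ℝ F) (u v : X) (t : ℝ) :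
    HasDerivAt (fun s : ℝ => F (u + s • v)) (fderiv ℝ F (u + t • v) v) t :=
  hasDerivAt_comp_line (hF _).hasFDerivAt

/-- Because the multiplier is `ω` itself, the mixed terms `ωα dN(u)w` and `ωβ dN(u)v` occur in both
Hessians and cancel; the `N''` terms leave `½ω² - ω² = -½ω²`. -/
theorem hessian_form (hF : ContDiff ℝ 2 F) (hN : ContDiff ℝ 2 N) (u v w : X) (ω α β : ℝ) :
    fderiv ℝ (fderiv ℝ (fun p : X × ℝ => F p.1 + 1 / 2 * p.2 ^ 2 * N p.1)) (u, ω) (v, α) (w, β) -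
      ω * fderiv ℝ (fderiv ℝ (fun p : X × ℝ => p.2 * N p.1)) (u, ω) (v, α) (w, β) =
    fderiv ℝ (fderiv ℝ F) u v w - 1 / 2 * ω ^ 2 * fderiv ℝ (fderiv ℝ N) u v w + α * β * N u := by
  have hF1 : Differentiable ℝ F := hF.differentiable (by norm_num)
  have hN1 : Differentiable ℝ N := hN.differentiable (by norm_num)
  have cE : ContDiff ℝ 2 (fun p : X × ℝ => F p.1 + 1 / 2 * p.2 ^ 2 * N p.1) := by fun_prop
  have cC : ContDiff ℝ 2 (fun p : X × ℝ => p.2 * N p.1) := by fun_prop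
  have dω : HasDerivAt (fun s : ℝ => ω + s * α) α 0 := by
    simpa using ((hasDerivAt_id (0 : ℝ)).mul_const α).const_add ω
  have dF := hasDerivAt_fderiv_line hF u v w
  have dN' := hasDerivAt_fderiv_line hN u v w
  have dN := hasDerivAt_line hN1 u v 0
  rw [fderiv_fderiv_eq_of_hasDerivAt cE (d := fderiv ℝ (fderiv ℝ F) u v w +
      (ω * α * fderiv ℝ N u w + 1 / 2 * ω ^ 2 * fderiv ℝ (fderiv ℝ N) u v w +
        (α * β * N u + ω * β * fderiv ℝ N u v))),
    fderiv_fderiv_eq_of_hasDerivAt cC (d := α * fderiv ℝ N u w +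
      ω * fderiv ℝ (fderiv ℝ N) u v w + β * fderiv ℝ N u v)]
  · ring
  · simp only [Prod.smul_mk, Prod.mk_add_mk, smul_eq_mul, fderiv_charge_form hN1]
    refine ((dω.mul dN').add (dN.const_mul β)).congr_deriv ?_
    simp
  · simp only [Prod.smul_mk, Prod.mk_add_mk, smul_eq_mul, fderiv_energy_form hF1 hN1]
    refine (dF.add ((((dω.pow 2).const_mul (1 / 2)).mul dN').add
      ((dω.mul_const β).mul dN))).congr_deriv ?_
    simp only [Pi.pow_apply, zero_mul, zero_smul, add_zero]
    ring

/-- The second-order necessary condition for a minimum of the energy at fixed charge. -/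
theorem reduced_hessian_nonneg (hF : ContDiff ℝ 2 F) (hN : ContDiff ℝ 2 N) {u : X} {ω : ℝ}
    (hNu : 0 < N u)
    (hmin : IsMinOn (fun p : X × ℝ => F p.1 + 1 / 2 * p.2 ^ 2 * N p.1)
      {p | p.2 * N p.1 = ω * N u} (u, ω)) (v : X) :
    0 ≤ fderiv ℝ (fderiv ℝ F) u v v - 1 / 2 * ω ^ 2 * fderiv ℝ (fderiv ℝ N) u v v +
      ω ^ 2 * fderiv ℝ N u v ^ 2 / N u := by
  have hF1 : Differentiable ℝ F := hF.differentiable (by norm_num)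
  have hN1 : Differentiable ℝ N := hN.differentiable (by norm_num)
  set σ := ω * N u
  set f : ℝ → ℝ := fun t => F (u + t • v)
  set n : ℝ → ℝ := fun t => N (u + t • v) with hn
  have hn0 : n 0 = N u := by simp [hn]
  have hnc : Continuous n := hN.continuous.comp (by fun_prop)
  have hpos : ∀ᶠ t in 𝓝 (0 : ℝ), 0 < n t :=
    hnc.continuousAt.eventually_mem (Ioi_mem_nhds (by rw [hn0]; exact hNu))
  -- The energy along the constraint curve `(u + t v, σ / n t)`: for small `t` the frequency is
  -- determined by the charge.
  set j : ℝ → ℝ := fun t => f t + σ ^ 2 / 2 * (n t)⁻¹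
  have h1 : ∀ᶠ t in 𝓝 (0 : ℝ), HasDerivAt j (fderiv ℝ F (u + t • v) v +
      σ ^ 2 / 2 * (-(fderiv ℝ N (u + t • v) v) / n t ^ 2)) t := by
    filter_upwards [hpos] with t ht
    exact (hasDerivAt_line hF1 u v t).add (((hasDerivAt_line hN1 u v t).inv ht.ne').const_mul _)
  have dn : HasDerivAt n (fderiv ℝ N u v) 0 := by simpa using hasDerivAt_line hN1 u v 0
  have h2 : HasDerivAt (fun t => fderiv ℝ F (u + t • v) v +
      σ ^ 2 / 2 * (-(fderiv ℝ N (u + t • v) v) / n t ^ 2)) _ 0 :=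
    (hasDerivAt_fderiv_line hF u v v).add
      (((hasDerivAt_fderiv_line hN u v v).neg.div (dn.pow 2)
        (by simp [hn0, hNu.ne'])).const_mul (σ ^ 2 / 2))
  have hloc : IsLocalMin j 0 := by
    filter_upwards [hpos] with t ht
    have hmem : (u + t • v, σ / n t) ∈ {p : X × ℝ | p.2 * N p.1 = σ} := by
      change σ / n t * n t = σ
      field_simp
    have h3 := hmin hmem
    change F u + 1 / 2 * ω ^ 2 * N u ≤ f t + 1 / 2 * (σ / n t) ^ 2 * n t at h3
    change f 0 + σ ^ 2 / 2 * (n 0)⁻¹ ≤ f t + σ ^ 2 / 2 * (n t)⁻¹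
    rw [hn0]
    have e1 : σ ^ 2 / 2 * (N u)⁻¹ = 1 / 2 * ω ^ 2 * N u := by
      simp only [σ]; field_simp
    have e2 : σ ^ 2 / 2 * (n t)⁻¹ = 1 / 2 * (σ / n t) ^ 2 * n t := by field_simp
    have e3 : f 0 = F u := by simp [f]
    rw [e1, e2, e3]
    exact h3
  have h4 := hloc.second_deriv_nonneg h1 h2
  refine h4.trans_eq ?_
  simp only [hn0, σ]
  simp only [Pi.pow_apply, hn0, Pi.neg_apply, zero_smul, add_zero]
  field_simp
  ring

end Constrained

/-! ### Linear algebra of a form `A` restricted to a hyperplane -/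

section Hyperplane

variable {X : Type*} [NormedAddCommGroup X] [NormedSpace ℝ X] {A : X →L[ℝ] X →L[ℝ] ℝ}
  {ℓ : X →L[ℝ] ℝ}
  {n ω : ℝ}

/-- If `Q v v = 0`, then `Q` at `v + t w` has no constant term in `t`, and a nonzero linear term
would make it negative for some `t`. -/
theorem nonneg_form_null_iff {Q : X →L[ℝ] X →L[ℝ] ℝ} (hs : ∀ v w, Q v w = Q w v)
    (h0 : ∀ v, 0 ≤ Q v v) {v : X} (hv : Q v v = 0) (w : X) : Q v w = 0 := by
  have h : ∀ t : ℝ, 0 ≤ 2 * t * Q v w + t ^ 2 * Q w w := by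
    intro t
    have h1 := h0 (v + t • w)
    simp only [map_add, add_apply, map_smul, smul_apply, smul_eq_mul, hv,
      hs w v] at h1
    linarith
  have h1 := h0 w
  by_contra hne
  -- Near the minimising `t`; the `+ 1` keeps the denominator positive when `Q w w = 0`.
  have h2 := h (-Q v w / (Q w w + 1))
  have h3 : 2 * (-Q v w / (Q w w + 1)) * Q v w + (-Q v w / (Q w w + 1)) ^ 2 * Q w w
      = -(Q v w ^ 2 * (Q w w + 2)) / (Q w w + 1) ^ 2 := by
    have : Q w w + 1 ≠ 0 := by positivity
    field_simp
    ring
  rw [h3] at h2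
  have h4 : 0 < Q v w ^ 2 * (Q w w + 2) / (Q w w + 1) ^ 2 := by positivity
  rw [neg_div] at h2
  linarith

/-- The trivial-kernel criterion for the form `A + ω² ℓ ⊗ ℓ / n` when `A S = ω ℓ`. -/
theorem reduced_form_nondegenerate_iff (hω : ω ≠ 0) (hn : n ≠ 0)
    (hker : ∀ v, (∀ w, A v w = 0) → v = 0) {S : X} (hS : ∀ w, A S w = ω * ℓ w) :
    (∀ v, (∀ w, A v w + ω ^ 2 * ℓ v * ℓ w / n = 0) → v = 0) ↔ n + ω * ℓ S ≠ 0 := by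
  constructor
  · intro h h0
    -- In the critical case `S` itself lies in the null space.
    have hS0 : S = 0 := h S fun w => by
      rw [hS]
      have : ω * ℓ w + ω ^ 2 * ℓ S * ℓ w / n = ω * ℓ w * (n + ω * ℓ S) / n := by field_simp
      rw [this, h0]; simp
    rw [hS0] at h0
    simp at h0
    exact hn h0
  · intro hne v hv
    -- A null vector satisfies `A v = -(ω² ℓ v / n) ℓ = c A S`, so `v = c S` by injectivity of `A`.
    -- Applying `ℓ` then yields `c (n + ω ℓ S) = 0`.
    set c := -(ω * ℓ v / n) with hc
    have h1 : v - c • S = 0 := hker _ fun w => by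
      simp only [map_sub, sub_apply, map_smul, smul_apply, hS, smul_eq_mul]
      rw [← hv w, hc]
      field_simp
      ring
    rw [sub_eq_zero] at h1
    have h2 : ℓ v = c * ℓ S := by rw [h1]; simp
    have h3 : c * (n + ω * ℓ S) = 0 := by
      rw [mul_add, show c * (ω * ℓ S) = ω * (c * ℓ S) by ring, ← h2, hc]
      field_simp
      ring
    rcases mul_eq_zero.1 h3 with h4 | h4
    · rw [h1, h4, zero_smul]
    · exact absurd h4 hne

/-- On the hyperplane `ω ℓ v + α n = 0` of `X × ℝ`, non-degeneracy and positivity of the form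
`A v w + α β n` are both equivalent to `n + ω ℓ S ≠ 0`, where `A S = ω ℓ`. -/
theorem hyperplane_form_iff (hω : ω ≠ 0) (hn : 0 < n) (hs : ∀ v w, A v w = A w v)
    (h0 : ∀ v, 0 ≤ A v v + ω ^ 2 * ℓ v ^ 2 / n)
    (hker : ∀ v, (∀ w, A v w = 0) → v = 0) {S : X} (hS : ∀ w, A S w = ω * ℓ w)
    {T : Set (X × ℝ)} (hT : ∀ p, p ∈ T ↔ ω * ℓ p.1 + p.2 * n = 0)
    {H : X × ℝ → X × ℝ → ℝ} (hH : ∀ p q, H p q = A p.1 q.1 + p.2 * q.2 * n) :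
    ((∀ p ∈ T, (∀ q ∈ T, H p q = 0) → p = 0) ↔ n + ω * ℓ S ≠ 0) ∧
      ((∀ p ∈ T, p ≠ 0 → 0 < H p p) ↔ n + ω * ℓ S ≠ 0) := by
  let Q : X →L[ℝ] X →L[ℝ] ℝ := A + (ω ^ 2 / n) • ℓ.smulRight ℓ
  have hQ : ∀ v w, Q v w = A v w + ω ^ 2 * ℓ v * ℓ w / n := by
    intro v w
    simp [Q]
    ring
  have hQs : ∀ v w, Q v w = Q w v := fun v w => by rw [hQ, hQ, hs]; ring
  have hQ0 : ∀ v, 0 ≤ Q v v := fun v => by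
    rw [hQ]
    refine (h0 v).trans_eq ?_
    ring
  -- Since `n ≠ 0`, the hyperplane is a graph over `X`, and `lift` carries `Q` to the restriction of
  -- `H`.
  let lift : X → X × ℝ := fun v => (v, -(ω * ℓ v / n))
  have hlift : ∀ v, lift v ∈ T := fun v => by
    rw [hT]
    simp only [lift]
    field_simp
    ring
  have hlift' : ∀ p ∈ T, p = lift p.1 := fun p hp => by
    rw [hT] at hp
    refine Prod.ext rfl ?_
    simp only [lift]
    field_simp
    linarith
  have hHQ : ∀ v w, H (lift v) (lift w) = Q v w := fun v w => by
    rw [hH, hQ]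
    simp only [lift]
    field_simp
  have key := reduced_form_nondegenerate_iff hω hn.ne' hker hS
  have e1 : (∀ p ∈ T, (∀ q ∈ T, H p q = 0) → p = 0) ↔
      ∀ v, (∀ w, A v w + ω ^ 2 * ℓ v * ℓ w / n = 0) → v = 0 := by
    simp only [← hQ]
    constructor
    · intro h v hv
      have h1 := h (lift v) (hlift v) fun q hq => by rw [hlift' q hq, hHQ, hv]
      exact congrArg Prod.fst h1
    · intro h p hp hq
      have h1 : p.1 = 0 := h p.1 fun w => by
        rw [← hHQ, ← hlift' p hp]
        exact hq _ (hlift w)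
      rw [hlift' p hp, h1]
      simp [lift]
  refine ⟨e1.trans key, Iff.trans ?_ (e1.trans key)⟩
  constructor
  · intro h p hp hq
    by_contra hne
    exact (h p hp hne).ne' (hq p hp)
  · intro h p hp hne
    have h1 : 0 ≤ H p p := by rw [hlift' p hp, hHQ]; exact hQ0 _
    refine lt_of_le_of_ne h1 fun h2 => hne (h p hp fun q hq => ?_)
    rw [hlift' p hp, hHQ] at h2
    rw [hlift' p hp, hlift' q hq, hHQ]
    exact nonneg_form_null_iff hQs hQ0 h2.symm _

end Hyperplane

/-! ### The space `H¹` -/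

instance H1.instNormedAddCommGroup : NormedAddCommGroup H1 := Submodule.normedAddCommGroup H1

instance H1.instNormedSpace : NormedSpace ℝ H1 := Submodule.normedSpace H1

instance H1r.instNormedAddCommGroup : NormedAddCommGroup H1r := Submodule.normedAddCommGroup H1r

instance H1r.instNormedSpace : NormedSpace ℝ H1r := Submodule.normedSpace H1r

theorem H1.isWeakDeriv (u : H1) : IsWeakDeriv (H1val u) (H1grad u) := u.2

def H1valL : H1 →L[ℝ] L2 := (WithLp.fstL 2 ℝ L2 L2).comp H1.subtypeL

def H1gradL : H1 →L[ℝ] L2 := (WithLp.sndL 2 ℝ L2 L2).comp H1.subtypeL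

theorem H1valL_apply (u : H1) : H1valL u = H1val u := rfl

theorem H1gradL_apply (u : H1) : H1gradL u = H1grad u := rfl

theorem H1.ext_val {u v : H1} (h : H1val u = H1val v) (h' : H1grad u = H1grad v) : u = v := by
  refine Subtype.ext ?_
  exact (WithLp.equiv 2 (L2 × L2)).injective (Prod.ext h h')

theorem H1.ae_abs_val_le (u : H1) : ∀ᵐ x, |H1val u x| ≤ 2 * ‖u‖ := by
  filter_upwards [(H1.isWeakDeriv u).ae_abs_le] with x hx
  have h1 : ‖H1val u‖ ≤ ‖u‖ := WithLp.norm_fst_le (p := 2) (x := (u : WithLp 2 (L2 × L2)))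
  have h2 : ‖H1grad u‖ ≤ ‖u‖ := WithLp.norm_snd_le (p := 2) (x := (u : WithLp 2 (L2 × L2)))
  linarith

theorem H1.memLp_val (u : H1) : MemLp (H1val u) 2 := Lp.memLp _

theorem H1.memLp_grad (u : H1) : MemLp (H1grad u) 2 := Lp.memLp _

theorem H1.memLp_top_val (u : H1) : MemLp (H1val u) ∞ :=
  memLp_top_of_bound (H1.memLp_val u).1 (2 * ‖u‖) (H1.ae_abs_val_le u)

theorem H1.val_line (u v : H1) (t : ℝ) :
    ∀ᵐ x, H1val (u + t • v) x = H1val u x + t * H1val v x := by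
  have h : H1val (u + t • v) = H1val u + t • H1val v := map_add H1valL u (t • v)
  rw [h]
  filter_upwards [Lp.coeFn_add (H1val u) (t • H1val v), Lp.coeFn_smul t (H1val v)] with x h1 h2
  rw [h1, Pi.add_apply, h2, Pi.smul_apply, smul_eq_mul]

theorem H1.grad_line (u v : H1) (t : ℝ) :
    ∀ᵐ x, H1grad (u + t • v) x = H1grad u x + t * H1grad v x := by
  have h : H1grad (u + t • v) = H1grad u + t • H1grad v := map_add H1gradL u (t • v)
  rw [h]
  filter_upwards [Lp.coeFn_add (H1grad u) (t • H1grad v), Lp.coeFn_smul t (H1grad v)]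
    with x h1 h2
  rw [h1, Pi.add_apply, h2, Pi.smul_apply, smul_eq_mul]

/-- The Sobolev embedding `H¹(ℝ) ⊆ L^∞(ℝ)`. -/
def H1toLinfty : H1 →L[ℝ] Lp ℝ ∞ (volume : Measure ℝ) :=
  LinearMap.mkContinuous
    { toFun := fun u => (H1.memLp_top_val u).toLp (H1val u)
      map_add' := fun u v => by
        refine Lp.ext ?_
        filter_upwards [(H1.memLp_top_val (u + v)).coeFn_toLp, (H1.memLp_top_val u).coeFn_toLp,
          (H1.memLp_top_val v).coeFn_toLp, Lp.coeFn_add ((H1.memLp_top_val u).toLp (H1val u))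
            ((H1.memLp_top_val v).toLp (H1val v)), H1.val_line u v 1] with x h1 h2 h3 h4 h5
        rw [h1, h4, Pi.add_apply, h2, h3]
        simpa using h5
      map_smul' := fun c u => by
        refine Lp.ext ?_
        filter_upwards [(H1.memLp_top_val (c • u)).coeFn_toLp, (H1.memLp_top_val u).coeFn_toLp,
          Lp.coeFn_smul c ((H1.memLp_top_val u).toLp (H1val u)), H1.val_line 0 u c,
          Lp.coeFn_zero ℝ 2 (volume : Measure ℝ)] with x h1 h2 h3 h4 h5
        rw [RingHom.id_apply, h1, h3, Pi.smul_apply, h2]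
        have h6 : H1val 0 x = 0 := h5
        rw [h6, zero_add, zero_add] at h4
        exact h4 }
    2 (fun u => by
      change ‖(H1.memLp_top_val u).toLp (H1val u)‖ ≤ 2 * ‖u‖
      rw [Lp.norm_toLp]
      refine ENNReal.toReal_le_of_le_ofReal (by positivity) ?_
      rw [eLpNorm_exponent_top]
      exact eLpNormEssSup_le_of_ae_bound (H1.ae_abs_val_le u))

theorem H1toLinfty_ae (u : H1) : ∀ᵐ x, H1toLinfty u x = H1val u x :=
  (H1.memLp_top_val u).coeFn_toLp

/-- Multiplication of an `L²` function by an `H¹` function. -/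
def H1mulL2 : H1 →L[ℝ] L2 →L[ℝ] L2 :=
  ((ContinuousLinearMap.mul ℝ ℝ).holderL volume ∞ 2 2).comp H1toLinfty

theorem H1mulL2_ae (u : H1) (f : L2) : ∀ᵐ x, H1mulL2 u f x = H1val u x * f x := by
  have h := (ContinuousLinearMap.mul ℝ ℝ).coeFn_holder (r := 2) (H1toLinfty u) f
  filter_upwards [h, H1toLinfty_ae u] with x h1 h2
  rw [← h2]
  exact h1

theorem L2.inner_eq_integral (f g : L2) : inner ℝ f g = ∫ x, f x * g x := by
  rw [MeasureTheory.L2.inner_def]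
  refine integral_congr_ae (Eventually.of_forall fun x => ?_)
  simp [mul_comm]

theorem contDiff_integral_grad_sq : ContDiff ℝ 2 fun u : H1 => ∫ x, H1grad u x ^ 2 := by
  have h : (fun u : H1 => ∫ x, H1grad u x ^ 2) = fun u => inner ℝ (H1gradL u) (H1gradL u) := by
    funext u
    rw [L2.inner_eq_integral]
    simp only [H1gradL_apply, sq]
  rw [h]
  exact H1gradL.contDiff.inner ℝ H1gradL.contDiff

theorem contDiff_integral_val_sq : ContDiff ℝ 2 fun u : H1 => ∫ x, H1val u x ^ 2 := by
  have h : (fun u : H1 => ∫ x, H1val u x ^ 2) = fun u => inner ℝ (H1valL u) (H1valL u) := by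
    funext u
    rw [L2.inner_eq_integral]
    simp only [H1valL_apply, sq]
  rw [h]
  exact H1valL.contDiff.inner ℝ H1valL.contDiff

theorem contDiff_H1_sq : ContDiff ℝ 2 fun u : H1 => H1mulL2 u (H1valL u) :=
  H1mulL2.contDiff.clm_apply H1valL.contDiff

/-- The integral is `‖u · u‖²` in `L²`, and `u ↦ u · u` is a bounded quadratic map from `H¹` to `L²`
because `H¹` embeds in `L^∞`. The sixth power uses `u · (u · u)` in the same way. -/
theorem contDiff_integral_val_pow_four : ContDiff ℝ 2 fun u : H1 => ∫ x, H1val u x ^ 4 := by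
  have h : (fun u : H1 => ∫ x, H1val u x ^ 4) =
      fun u => inner ℝ (H1mulL2 u (H1valL u)) (H1mulL2 u (H1valL u)) := by
    funext u
    rw [L2.inner_eq_integral]
    refine integral_congr_ae ?_
    filter_upwards [H1mulL2_ae u (H1valL u)] with x hx
    rw [hx, H1valL_apply]
    ring
  rw [h]
  exact contDiff_H1_sq.inner ℝ contDiff_H1_sq

theorem contDiff_integral_val_pow_six : ContDiff ℝ 2 fun u : H1 => ∫ x, H1val u x ^ 6 := by
  have h : (fun u : H1 => ∫ x, H1val u x ^ 6) =
      fun u => inner ℝ (H1mulL2 u (H1mulL2 u (H1valL u))) (H1mulL2 u (H1mulL2 u (H1valL u))) := by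
    funext u
    rw [L2.inner_eq_integral]
    refine integral_congr_ae ?_
    filter_upwards [H1mulL2_ae u (H1valL u), H1mulL2_ae u (H1mulL2 u (H1valL u))] with x hx hy
    rw [hy, hx, H1valL_apply]
    ring
  rw [h]
  have h3 : ContDiff ℝ 2 fun u : H1 => H1mulL2 u (H1mulL2 u (H1valL u)) :=
    H1mulL2.contDiff.clm_apply contDiff_H1_sq
  exact h3.inner ℝ h3

/-! ### Derivatives of integrals of powers along lines -/

/-- Differentiation under the integral, dominated for `|t| < 1` by replacing `p + t q` with `|p| +
|q|`. The weight `w` is `1` for first derivatives of the functionals and the second direction for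
Hessians. -/
theorem hasDerivAt_integral_add_mul_pow {α : Type*} [MeasurableSpace α] {μ : Measure α}
    {p q w : α → ℝ} (hp : AEStronglyMeasurable p μ) (hq : AEStronglyMeasurable q μ)
    (hw : AEStronglyMeasurable w μ) (n : ℕ) (h0 : Integrable (fun x => p x ^ (n + 1) * w x) μ)
    (hb : Integrable (fun x => (|p x| + |q x|) ^ n * (|q x| * |w x|)) μ) :
    HasDerivAt (fun t : ℝ => ∫ x, (p x + t * q x) ^ (n + 1) * w x ∂μ)
      ((n + 1) * ∫ x, p x ^ n * (q x * w x) ∂μ) 0 := by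
  have h := hasDerivAt_integral_of_dominated_loc_of_deriv_le (μ := μ) (x₀ := (0 : ℝ))
    (s := Metric.ball 0 1) (F := fun t x => (p x + t * q x) ^ (n + 1) * w x)
    (F' := fun t x => (n + 1) * ((p x + t * q x) ^ n * (q x * w x)))
    (bound := fun x => (n + 1) * ((|p x| + |q x|) ^ n * (|q x| * |w x|)))
    (Metric.ball_mem_nhds _ one_pos)
    (Eventually.of_forall fun t => ((hp.add (hq.const_mul t)).pow (n + 1)).mul hw)
    (by simpa using h0) (by
      simp only [zero_mul, add_zero]
      exact ((hp.pow n).mul (hq.mul hw)).const_mul _)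
    (Eventually.of_forall fun x t ht => by
      rw [Metric.mem_ball, dist_zero_right, Real.norm_eq_abs] at ht
      rw [norm_mul, norm_mul, norm_mul, norm_pow]
      simp only [Real.norm_eq_abs]
      have h1 : |p x + t * q x| ≤ |p x| + |q x| := by
        refine (abs_add_le _ _).trans ?_
        rw [abs_mul]
        nlinarith [abs_nonneg (q x)]
      have h2 : |((n : ℝ) + 1)| = n + 1 := abs_of_nonneg (by positivity)
      rw [h2]
      gcongr)
    (hb.const_mul _)
    (Eventually.of_forall fun x t _ => by
      have h1 : HasDerivAt (fun t : ℝ => p x + t * q x) (q x) t := by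
        simpa using ((hasDerivAt_id t).mul_const (q x)).const_add (p x)
      refine ((h1.pow (n + 1)).mul_const (w x)).congr_deriv ?_
      push_cast
      ring)
  simpa [integral_const_mul] using h.2

/-- Products of two square-integrable functions with a power of a bounded function. -/
theorem integrable_pow_mul_mul {α : Type*} [MeasurableSpace α] {μ : Measure α} {p q w : α → ℝ}
    (hp : MemLp p ∞ μ) (hq : MemLp q 2 μ) (hw : MemLp w 2 μ) (n : ℕ) :
    Integrable (fun x => p x ^ n * (q x * w x)) μ := by
  induction n with
  | zero =>
    simp only [pow_zero, one_mul]
    exact hq.integrable_mul hw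
  | succ n ih =>
    have h1 : MemLp (fun x => p x ^ n * (q x * w x)) 1 μ := memLp_one_iff_integrable.2 ih
    have h2 := hp.integrable_mul h1
    refine h2.congr (Eventually.of_forall fun x => ?_)
    simp only [Pi.mul_apply]
    ring

theorem hasDerivAt_integral_line_pow {α : Type*} [MeasurableSpace α] {μ : Measure α}
    {p q : α → ℝ} (hp : MemLp p 2 μ) (hq : MemLp q 2 μ) (hp' : MemLp p ∞ μ) (hq' : MemLp q ∞ μ)
    (n : ℕ) :
    HasDerivAt (fun t : ℝ => ∫ x, (p x + t * q x) ^ (n + 2) ∂μ)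
      ((n + 2) * ∫ x, p x ^ (n + 1) * q x ∂μ) 0 := by
  have h := hasDerivAt_integral_add_mul_pow (w := fun _ => 1) hp.1 hq.1
    aestronglyMeasurable_const (n + 1)
    ((integrable_pow_mul_mul hp' hp hp n).congr (Eventually.of_forall fun x => by
      simp only; ring))
    ((integrable_pow_mul_mul (hp'.abs.add hq'.abs) (hp.abs.add hq.abs) hq.abs n).congr
      (Eventually.of_forall fun x => by
        simp only [Pi.add_apply, Pi.abs_apply, abs_one]; ring))
  convert h using 1
  · simp
  · push_cast
    simp only [mul_one]
    ring

theorem hasDerivAt_integral_line_pow_mul {α : Type*} [MeasurableSpace α] {μ : Measure α}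
    {p q w : α → ℝ} (hp : MemLp p 2 μ) (hq : MemLp q 2 μ) (hw : MemLp w 2 μ) (hp' : MemLp p ∞ μ)
    (hq' : MemLp q ∞ μ) (n : ℕ) :
    HasDerivAt (fun t : ℝ => ∫ x, (p x + t * q x) ^ (n + 1) * w x ∂μ)
      ((n + 1) * ∫ x, p x ^ n * (q x * w x) ∂μ) 0 :=
  hasDerivAt_integral_add_mul_pow hp.1 hq.1 hw.1 n
    ((integrable_pow_mul_mul hp' hp hw n).congr (Eventually.of_forall fun x => by
      simp only; ring))
    (integrable_pow_mul_mul (hp'.abs.add hq'.abs) hq.abs hw.abs n)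

/-- For the gradients, which are square-integrable but need not be bounded. -/
theorem hasDerivAt_integral_line_sq {α : Type*} [MeasurableSpace α] {μ : Measure α}
    {p q : α → ℝ} (hp : MemLp p 2 μ) (hq : MemLp q 2 μ) :
    HasDerivAt (fun t : ℝ => ∫ x, (p x + t * q x) ^ 2 ∂μ) (2 * ∫ x, p x * q x ∂μ) 0 := by
  have h := hasDerivAt_integral_add_mul_pow (w := fun _ => 1) hp.1 hq.1
    aestronglyMeasurable_const 1
    ((hp.integrable_mul hp).congr (Eventually.of_forall fun x => by
      simp only [Pi.mul_apply]; ring))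
    (((hp.abs.add hq.abs).integrable_mul hq.abs).congr (Eventually.of_forall fun x => by
      simp only [Pi.add_apply, Pi.mul_apply, Pi.abs_apply, abs_one]; ring))
  convert h using 1
  · simp
  · simp only [mul_one, pow_one, Nat.cast_one]
    ring

theorem hasDerivAt_integral_line_mul {α : Type*} [MeasurableSpace α] {μ : Measure α}
    {p q w : α → ℝ} (hp : MemLp p 2 μ) (hq : MemLp q 2 μ) (hw : MemLp w 2 μ) :
    HasDerivAt (fun t : ℝ => ∫ x, (p x + t * q x) * w x ∂μ) (∫ x, q x * w x ∂μ) 0 := by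
  have h := hasDerivAt_integral_add_mul_pow hp.1 hq.1 hw.1 0
    ((hp.integrable_mul hw).congr (Eventually.of_forall fun x => by
      simp only [Pi.mul_apply]; ring))
    ((hq.abs.integrable_mul hw.abs).congr (Eventually.of_forall fun x => by
      simp only [Pi.mul_apply, Pi.abs_apply]; ring))
  simpa using h

/-! ### Energy and charge on `H¹_r` and their derivatives -/

/-- The energy of `(u, 0)`. -/
def staticEnergy (a b m : ℝ) (u : H1r) : ℝ :=
  1 / 2 * ((∫ x, H1grad u x ^ 2) + m ^ 2 * ∫ x, H1val u x ^ 2) - a * (∫ x, H1val u x ^ 4) +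
    b * ∫ x, H1val u x ^ 6

/-- The squared `L²` norm. -/
def mass (u : H1r) : ℝ := ∫ x, H1val u x ^ 2

theorem contDiff_staticEnergy (a b m : ℝ) : ContDiff ℝ 2 (staticEnergy a b m) := by
  have h : ContDiff ℝ 2 (fun u : H1r => (u : H1)) := H1r.subtypeL.contDiff
  have h1 := contDiff_integral_grad_sq.comp h
  have h2 := contDiff_integral_val_sq.comp h
  have h4 := contDiff_integral_val_pow_four.comp h
  have h6 := contDiff_integral_val_pow_six.comp h
  exact ((contDiff_const.mul (h1.add (contDiff_const.mul h2))).sub (contDiff_const.mul h4)).add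
    (contDiff_const.mul h6)

theorem contDiff_mass : ContDiff ℝ 2 mass := by
  have h : ContDiff ℝ 2 (fun u : H1r => (u : H1)) := H1r.subtypeL.contDiff
  exact contDiff_integral_val_sq.comp h

theorem chargeR_eq : chargeR = fun p : H1r × ℝ => p.2 * mass p.1 := rfl

/-- Brings the energy into the abstract form `F(u) + ½ω²N(u)`; the absolute values in `W` disappear
because only even powers occur. -/
theorem energyR_eq (a b m : ℝ) :
    energyR a b m = fun p : H1r × ℝ => staticEnergy a b m p.1 + 1 / 2 * p.2 ^ 2 * mass p.1 := by
  funext ⟨u, ω⟩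
  unfold energyR energy staticEnergy mass
  simp only
  set p := H1val (u : H1)
  set g := H1grad (u : H1)
  have hp := H1.memLp_val (u : H1)
  have hp' := H1.memLp_top_val (u : H1)
  have hg := H1.memLp_grad (u : H1)
  have i1 : Integrable fun x => g x ^ 2 := hg.integrable_sq
  have i2 : Integrable fun x => p x ^ 2 := hp.integrable_sq
  have i4 : Integrable fun x => p x ^ 4 :=
    (integrable_pow_mul_mul hp' hp hp 2).congr (Eventually.of_forall fun x => by simp only; ring)
  have i6 : Integrable fun x => p x ^ 6 :=
    (integrable_pow_mul_mul hp' hp hp 4).congr (Eventually.of_forall fun x => by simp only; ring)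
  have e : ∀ x, g x ^ 2 + ω ^ 2 * p x ^ 2 + 2 * W a b m (p x) =
      g x ^ 2 + (ω ^ 2 + m ^ 2) * p x ^ 2 - 2 * a * p x ^ 4 + 2 * b * p x ^ 6 := by
    intro x
    unfold W G
    have h2 : |p x| ^ 2 = p x ^ 2 := sq_abs _
    rw [show |p x| ^ 4 = (|p x| ^ 2) ^ 2 by ring, show |p x| ^ 6 = (|p x| ^ 2) ^ 3 by ring, h2]
    ring
  simp only [e]
  have j2 := i2.const_mul (ω ^ 2 + m ^ 2)
  have j4 := i4.const_mul (2 * a)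
  have j6 := i6.const_mul (2 * b)
  have j12 : Integrable fun x => g x ^ 2 + (ω ^ 2 + m ^ 2) * p x ^ 2 := i1.add j2
  have j124 : Integrable fun x => g x ^ 2 + (ω ^ 2 + m ^ 2) * p x ^ 2 - 2 * a * p x ^ 4 :=
    j12.sub j4
  rw [integral_add j124 j6, integral_sub j12 j4, integral_add i1 j2,
    integral_const_mul, integral_const_mul, integral_const_mul]
  ring

section Derivatives

variable (a b m : ℝ) (u v w : H1r)

theorem hasDerivAt_integral_val_pow (n : ℕ) :
    HasDerivAt (fun t : ℝ => ∫ x, H1val ((u + t • v : H1r) : H1) x ^ (n + 2))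
      ((n + 2) * ∫ x, H1val u x ^ (n + 1) * H1val v x) 0 := by
  have h := hasDerivAt_integral_line_pow (H1.memLp_val u) (H1.memLp_val v) (H1.memLp_top_val u)
    (H1.memLp_top_val v) n
  convert h using 2 with t
  refine integral_congr_ae ?_
  filter_upwards [H1.val_line u v t] with x hx
  rw [← hx]
  rfl

theorem hasDerivAt_integral_val_pow_mul (n : ℕ) :
    HasDerivAt (fun t : ℝ => ∫ x, H1val ((u + t • v : H1r) : H1) x ^ (n + 1) * H1val w x)
      ((n + 1) * ∫ x, H1val u x ^ n * (H1val v x * H1val w x)) 0 := by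
  have h := hasDerivAt_integral_line_pow_mul (H1.memLp_val u) (H1.memLp_val v) (H1.memLp_val w)
    (H1.memLp_top_val u) (H1.memLp_top_val v) n
  convert h using 2 with t
  refine integral_congr_ae ?_
  filter_upwards [H1.val_line u v t] with x hx
  rw [← hx]
  rfl

theorem hasDerivAt_integral_grad_sq :
    HasDerivAt (fun t : ℝ => ∫ x, H1grad ((u + t • v : H1r) : H1) x ^ 2)
      (2 * ∫ x, H1grad u x * H1grad v x) 0 := by
  have h := hasDerivAt_integral_line_sq (H1.memLp_grad u) (H1.memLp_grad v)
  convert h using 2 with t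
  refine integral_congr_ae ?_
  filter_upwards [H1.grad_line u v t] with x hx
  rw [← hx]
  rfl

theorem hasDerivAt_integral_grad_mul :
    HasDerivAt (fun t : ℝ => ∫ x, H1grad ((u + t • v : H1r) : H1) x * H1grad w x)
      (∫ x, H1grad v x * H1grad w x) 0 := by
  have h := hasDerivAt_integral_line_mul (H1.memLp_grad u) (H1.memLp_grad v) (H1.memLp_grad w)
  convert h using 2 with t
  refine integral_congr_ae ?_
  filter_upwards [H1.grad_line u v t] with x hx
  rw [← hx]
  rfl

theorem fderiv_mass : fderiv ℝ mass u v = 2 * ∫ x, H1val u x * H1val v x := by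
  have h1 := hasDerivAt_line (contDiff_mass.differentiable (by norm_num)) u v 0
  have h2 := hasDerivAt_integral_val_pow u v 0
  have h3 := h1.unique h2
  simpa using h3

theorem fderiv_fderiv_mass : fderiv ℝ (fderiv ℝ mass) u v w = 2 * ∫ x, H1val v x * H1val w x := by
  refine fderiv_fderiv_eq_of_hasDerivAt contDiff_mass ?_
  simp only [fderiv_mass]
  have h := (hasDerivAt_integral_val_pow_mul u v w 0).const_mul 2
  simpa using h

/-- The exponents stay in the form `n + 1` so that `hasDerivAt_integral_val_pow_mul` matches each
term when differentiating again. -/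
theorem fderiv_staticEnergy :
    fderiv ℝ (staticEnergy a b m) u v = (∫ x, H1grad u x * H1grad v x) +
      m ^ 2 * (∫ x, H1val u x ^ (0 + 1) * H1val v x) -
      4 * a * (∫ x, H1val u x ^ (2 + 1) * H1val v x) +
        6 * b * ∫ x, H1val u x ^ (4 + 1) * H1val v x := by
  have h1 := hasDerivAt_line ((contDiff_staticEnergy a b m).differentiable (by norm_num)) u v 0
  have h2 := ((((hasDerivAt_integral_grad_sq u v).add
    ((hasDerivAt_integral_val_pow u v 0).const_mul (m ^ 2))).const_mul (1 / 2)).sub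
    ((hasDerivAt_integral_val_pow u v 2).const_mul a)).add
    ((hasDerivAt_integral_val_pow u v 4).const_mul b)
  have h3 := h1.unique h2
  rw [zero_smul, add_zero] at h3
  rw [h3]
  push_cast
  ring

theorem fderiv_fderiv_staticEnergy :
    fderiv ℝ (fderiv ℝ (staticEnergy a b m)) u v w = (∫ x, H1grad v x * H1grad w x) +
      m ^ 2 * (∫ x, H1val v x * H1val w x) -
      12 * a * (∫ x, H1val u x ^ 2 * (H1val v x * H1val w x)) +
        30 * b * ∫ x, H1val u x ^ 4 * (H1val v x * H1val w x) := by
  refine fderiv_fderiv_eq_of_hasDerivAt (contDiff_staticEnergy a b m) ?_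
  simp only [fderiv_staticEnergy]
  have h := (((hasDerivAt_integral_grad_mul u v w).add
    ((hasDerivAt_integral_val_pow_mul u v w 0).const_mul (m ^ 2))).sub
    ((hasDerivAt_integral_val_pow_mul u v w 2).const_mul (4 * a))).add
    ((hasDerivAt_integral_val_pow_mul u v w 4).const_mul (6 * b))
  refine h.congr_deriv ?_
  push_cast
  simp only [pow_zero, one_mul]
  ring

end Derivatives

/-- The potential of the linearised operator at `u`. -/
def linPotential (a b m ω s : ℝ) : ℝ := m ^ 2 - ω ^ 2 - 12 * a * s ^ 2 + 30 * b * s ^ 4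

/-- The bilinear form of the linearised operator at `u`. -/
def linForm (a b m ω : ℝ) (u : H1r) : H1r →L[ℝ] H1r →L[ℝ] ℝ :=
  fderiv ℝ (fderiv ℝ (staticEnergy a b m)) u - (1 / 2 * ω ^ 2) • fderiv ℝ (fderiv ℝ mass) u

/-- The quadratic form of `-d²/dx² + G''(u) + m² - ω²`. -/
theorem linForm_apply (a b m ω : ℝ) (u v w : H1r) :
    linForm a b m ω u v w = (∫ x, H1grad v x * H1grad w x) +
      ∫ x, linPotential a b m ω (H1val u x) * H1val v x * H1val w x := by
  have hv := H1.memLp_val v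
  have hw := H1.memLp_val w
  have i0 : Integrable fun x => H1val v x * H1val w x := hv.integrable_mul hw
  have i2 := integrable_pow_mul_mul (H1.memLp_top_val u) hv hw 2
  have i4 := integrable_pow_mul_mul (H1.memLp_top_val u) hv hw 4
  have e : ∀ x, linPotential a b m ω (H1val u x) * H1val v x * H1val w x =
      (m ^ 2 - ω ^ 2) * (H1val v x * H1val w x) -
        12 * a * (H1val u x ^ 2 * (H1val v x * H1val w x)) +
        30 * b * (H1val u x ^ 4 * (H1val v x * H1val w x)) := by
    intro x
    unfold linPotential
    ring
  simp only [e]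
  have j0 := i0.const_mul (m ^ 2 - ω ^ 2)
  have j2 := i2.const_mul (12 * a)
  have j4 := i4.const_mul (30 * b)
  have j02 : Integrable fun x => (m ^ 2 - ω ^ 2) * (H1val v x * H1val w x) -
      12 * a * (H1val u x ^ 2 * (H1val v x * H1val w x)) := j0.sub j2
  rw [integral_add j02 j4, integral_sub j0 j2, integral_const_mul, integral_const_mul,
    integral_const_mul]
  simp only [linForm, sub_apply, smul_apply, smul_eq_mul,
    fderiv_fderiv_staticEnergy, fderiv_fderiv_mass]
  ring

/-- Non-degeneracy and positivity at a minimum, in terms of a solution `S` of the linearised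
equation with right-hand side `2 ω u`. -/
theorem nondegenerate_and_posDef_iff {a b m ω : ℝ} (hω : ω ≠ 0) {u S : H1r} (hu : 0 < mass u)
    (hmin : IsRadialMinimum a b m (u, ω))
    (hker : ∀ v, (∀ w, linForm a b m ω u v w = 0) → v = 0)
    (hS : ∀ w : H1r, linForm a b m ω u S w = 2 * ω * ∫ x, H1val u x * H1val w x) :
    (IsNondegenerate a b m (u, ω) ↔ mass u + 2 * ω * (∫ x, H1val u x * H1val S x) ≠ 0) ∧
      (HasPosDefHessian a b m (u, ω) ↔
        mass u + 2 * ω * (∫ x, H1val u x * H1val S x) ≠ 0) := by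
  have cF := contDiff_staticEnergy a b m
  have hmin' := hmin
  unfold IsRadialMinimum constraintR at hmin'
  rw [energyR_eq, chargeR_eq] at hmin'
  have h0 := reduced_hessian_nonneg cF contDiff_mass hu hmin'
  have h := hyperplane_form_iff (A := linForm a b m ω u) (ℓ := fderiv ℝ mass u) (S := S)
    (T := (tangentSpaceR (u, ω) : Set (H1r × ℝ))) (H := constrainedHessian a b m (u, ω)) hω hu
    (fun v w => by
      simp only [linForm_apply]
      congr 1 <;> exact integral_congr_ae (Eventually.of_forall fun x => by simp only; ring))
    (fun v => by simpa [linForm] using h0 v) hker (fun w => by rw [hS, fderiv_mass]; ring)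
    (fun p => by
      change (fderiv ℝ chargeR (u, ω)) p = 0 ↔ _
      rw [chargeR_eq]
      exact Eq.congr_left
        (fderiv_charge_form (contDiff_mass.differentiable (by norm_num)) u p.1 ω p.2))
    (fun p q => by
      unfold constrainedHessian
      rw [energyR_eq, chargeR_eq]
      have := hessian_form cF contDiff_mass u p.1 q.1 ω p.2 q.2
      refine this.trans ?_
      simp [linForm])
  rw [fderiv_mass] at h
  have e : mass u + ω * (2 * ∫ x, H1val u x * H1val S x) =
      mass u + 2 * ω * ∫ x, H1val u x * H1val S x := by ring
  rw [e] at h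
  exact h

/-! ### Classical functions as elements of `H¹_r` -/

/-- The element of `H¹_r` given by an even differentiable function. -/
def H1r.ofFun {f f' : ℝ → ℝ} (hd : ∀ x, HasDerivAt f (f' x) x) (hf : MemLp f 2)
    (hf' : MemLp f' 2) (he : ∀ x, f (-x) = f x) : H1r :=
  ⟨⟨WithLp.toLp 2 (hf.toLp f, hf'.toLp f'), isWeakDeriv_toLp hd hf hf'⟩, by
    change ∀ᵐ x : ℝ, (hf.toLp f) (-x) = (hf.toLp f) x
    have h := hf.coeFn_toLp
    have h' := (Measure.measurePreserving_neg (volume : Measure ℝ)).quasiMeasurePreserving.ae h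
    filter_upwards [h, h'] with x h1 h2
    rw [h1, h2, he]⟩

theorem H1r.val_ofFun {f f' : ℝ → ℝ} (hd : ∀ x, HasDerivAt f (f' x) x) (hf : MemLp f 2)
    (hf' : MemLp f' 2) (he : ∀ x, f (-x) = f x) :
    (H1val (H1r.ofFun hd hf hf' he) : ℝ → ℝ) =ᵐ[volume] f := hf.coeFn_toLp

theorem H1r.grad_ofFun {f f' : ℝ → ℝ} (hd : ∀ x, HasDerivAt f (f' x) x) (hf : MemLp f 2)
    (hf' : MemLp f' 2) (he : ∀ x, f (-x) = f x) :
    (H1grad (H1r.ofFun hd hf hf' he) : ℝ → ℝ) =ᵐ[volume] f' := hf'.coeFn_toLp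

/-- Integration by parts of the derivative of a classical function against an `H¹` function. -/
theorem integral_mul_grad_eq_neg {f f' : ℝ → ℝ} (hd : ∀ x, HasDerivAt f (f' x) x) (hf : MemLp f 2)
    (hf' : MemLp f' 2) (w : H1) : ∫ x, f x * H1grad w x = - ∫ x, f' x * H1val w x := by
  have h := (isWeakDeriv_toLp hd hf hf').integral_mul_eq_neg (H1.isWeakDeriv w)
  have e1 : ∫ x, hf.toLp f x * H1grad w x = ∫ x, f x * H1grad w x := by
    refine integral_congr_ae ?_
    filter_upwards [hf.coeFn_toLp] with x hx
    rw [hx]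
  have e2 : ∫ x, hf'.toLp f' x * H1val w x = ∫ x, f' x * H1val w x := by
    refine integral_congr_ae ?_
    filter_upwards [hf'.coeFn_toLp] with x hx
    rw [hx]
  rw [← e1, h, e2]

theorem integral_comp_neg_of_even {f : ℝ → ℝ} (hf : ∀ᵐ x, f (-x) = f x) (φ : ℝ → ℝ) :
    ∫ x, f x * φ (-x) = ∫ x, f x * φ x := by
  rw [← integral_neg_eq_self (fun x => f x * φ x)]
  refine integral_congr_ae ?_
  filter_upwards [hf] with x hx
  simp only [hx]

/-! ### The even kernel of a Schrödinger operator -/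

section Kernel

variable {q P Q : ℝ → ℝ} {B : ℝ}

theorem memLp_mul_of_bound (hq : Continuous q) (hB : ∀ x, |q x| ≤ B) {f : ℝ → ℝ}
    (hf : MemLp f 2) : MemLp (fun x => q x * f x) 2 := by
  refine hf.of_le_mul (c := B) (hq.aestronglyMeasurable.mul hf.1) (Eventually.of_forall fun x => ?_)
  rw [norm_mul]
  exact mul_le_mul_of_nonneg_right (hB x) (norm_nonneg _)

/-- A weak solution of `v'' = q v` on even test functions is a weak solution. -/
theorem isWeakDeriv_of_even_weak_solution (hq : Continuous q) (hB : ∀ x, |q x| ≤ B)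
    (hqe : ∀ x, q (-x) = q x) {v : H1r}
    (hv : ∀ w : H1r, (∫ x, H1grad v x * H1grad w x) + ∫ x, q x * H1val v x * H1val w x = 0) :
    IsWeakDeriv (H1grad v) ((memLp_mul_of_bound hq hB (H1.memLp_val (v : H1))).toLp
      (fun x => q x * H1val v x)) := by
  intro φ hφ hc
  have hL := memLp_mul_of_bound hq hB (H1.memLp_val (v : H1))
  have e0 : ∫ x, (hL.toLp fun x => q x * H1val v x) x * φ x = ∫ x, q x * H1val v x * φ x := by
    refine integral_congr_ae ?_
    filter_upwards [hL.coeFn_toLp] with x hx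
    rw [hx]
  rw [e0]
  have hc' : HasCompactSupport fun x => φ (-x) := hc.comp_homeomorph (Homeomorph.neg ℝ)
  have hψ : ContDiff ℝ (⊤ : ℕ∞) fun x => φ (-x) := hφ.comp contDiff_neg
  have hdφ : ∀ x, HasDerivAt φ (deriv φ x) x := fun x =>
    (hφ.differentiable (by simp) x).hasDerivAt
  have hdψ : ∀ x, HasDerivAt (fun x => φ (-x)) (-deriv φ (-x)) x := fun x => by
    exact ((hdφ (-x)).comp x (hasDerivAt_neg x)).congr_deriv (by ring)
  have hφ' : ContDiff ℝ (⊤ : ℕ∞) (deriv φ) := (contDiff_infty_iff_deriv.1 hφ).2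
  have hψ' : ContDiff ℝ (⊤ : ℕ∞) fun x => deriv φ (-x) := hφ'.comp contDiff_neg
  have hcψ' : HasCompactSupport fun x => deriv φ (-x) :=
    hc.deriv.comp_homeomorph (Homeomorph.neg ℝ)
  have mφ : MemLp φ 2 := hφ.continuous.memLp_of_hasCompactSupport hc
  have mψ : MemLp (fun x => φ (-x)) 2 := hψ.continuous.memLp_of_hasCompactSupport hc'
  have m1 : MemLp (fun x => φ x + φ (-x)) 2 := mφ.add mψ
  have m2 : MemLp (fun x => deriv φ x + -deriv φ (-x)) 2 :=
    (hφ'.continuous.memLp_of_hasCompactSupport hc.deriv).add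
      (hψ'.continuous.memLp_of_hasCompactSupport hcψ').neg
  have hsum : ∀ x, HasDerivAt (fun x => φ x + φ (-x)) (deriv φ x + -deriv φ (-x)) x := fun x =>
    (hdφ x).add (hdψ x)
  have hev : ∀ x, φ (-x) + φ (- -x) = φ x + φ (-x) := fun x => by rw [neg_neg, add_comm]
  -- An arbitrary test function is symmetrised to `φ(x) + φ(-x)`. Since `v` and `q` are even and
  -- `v'` is odd, this yields twice the equation for `φ`.
  let w := H1r.ofFun hsum m1 m2 hev
  have h := hv w
  have hve : ∀ᵐ x : ℝ, H1val (v : H1) (-x) = H1val (v : H1) x := v.2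
  have i1 := L2.integrable_mul (H1grad (v : H1)) hφ'.continuous hc.deriv
  have i2 := L2.integrable_mul (H1grad (v : H1)) hψ'.continuous hcψ'
  have i3 : Integrable fun x => q x * H1val v x * φ x :=
    hL.integrable_mul mφ
  have i4 : Integrable fun x => q x * H1val v x * φ (-x) :=
    hL.integrable_mul mψ
  have e1 : ∫ x, H1grad v x * H1grad w x =
      (∫ x, H1grad v x * deriv φ x) - ∫ x, H1grad v x * deriv φ (-x) := by
    rw [← integral_sub i1 i2]
    refine integral_congr_ae ?_
    filter_upwards [H1r.grad_ofFun hsum m1 m2 hev] with x hx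
    rw [hx]
    ring
  have e2 : ∫ x, q x * H1val v x * H1val w x =
      (∫ x, q x * H1val v x * φ x) + ∫ x, q x * H1val v x * φ (-x) := by
    rw [← integral_add i3 i4]
    refine integral_congr_ae ?_
    filter_upwards [H1r.val_ofFun hsum m1 m2 hev] with x hx
    rw [hx]
    ring
  have e3 : ∫ x, q x * H1val v x * φ (-x) = ∫ x, q x * H1val v x * φ x :=
    integral_comp_neg_of_even (f := fun x => q x * H1val v x)
      (by filter_upwards [hve] with x hx; rw [hx, hqe]) φ
  -- Oddness of `v'` in weak form, from testing the weak derivative of the even `v` against `deriv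
  -- φ` and its reflection.
  have e4 : ∫ x, H1grad v x * deriv φ (-x) = - ∫ x, H1grad v x * deriv φ x := by
    have w1 := H1.isWeakDeriv (v : H1) _ hφ' hc.deriv
    have w2 := H1.isWeakDeriv (v : H1) _ hψ' hcψ'
    have hd2 : deriv (fun x => deriv φ (-x)) = fun x => -deriv (deriv φ) (-x) := by
      funext x
      exact deriv_comp_neg (deriv φ) x
    rw [hd2] at w2
    simp only [mul_neg, integral_neg] at w2
    rw [integral_comp_neg_of_even hve] at w2
    linarith
  rw [e1, e2, e3, e4] at h
  linarith

/-- An even `H¹` solution of `v'' = q v` vanishes if the equation has a non-trivial odd solution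
in `H¹`. -/
theorem even_kernel_trivial (hq : Continuous q) (hB : ∀ x, |q x| ≤ B) (hqe : ∀ x, q (-x) = q x)
    (hP : ∀ x, HasDerivAt P (Q x) x) (hQ : ∀ x, HasDerivAt Q (q x * P x) x) (hP2 : MemLp P 2)
    (hQ2 : MemLp Q 2) (hP0 : P 0 = 0) (hQ0 : Q 0 ≠ 0) {v : H1r}
    (hv : ∀ w : H1r, (∫ x, H1grad v x * H1grad w x) + ∫ x, q x * H1val v x * H1val w x = 0) :
    v = 0 := by
  have hL := memLp_mul_of_bound hq hB (H1.memLp_val (v : H1))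
  obtain ⟨c, hc⟩ := (H1.isWeakDeriv (v : H1)).exists_ae_eq_primitive
  obtain ⟨d, hd⟩ := (isWeakDeriv_of_even_weak_solution hq hB hqe hv).exists_ae_eq_primitive
  set U : ℝ → ℝ := fun x => c + ∫ t in (0 : ℝ)..x, H1grad v t with hU
  set Y : ℝ → ℝ := fun x => d + ∫ t in (0 : ℝ)..x, (hL.toLp fun x => q x * H1val v x) t with hY
  have cU : Continuous U := continuous_primitive_of_locallyIntegrable (L2.locallyIntegrable _) c
  have cY : Continuous Y := continuous_primitive_of_locallyIntegrable (L2.locallyIntegrable _) d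
  have hU' : U = fun x => c + ∫ t in (0 : ℝ)..x, Y t := by
    funext x
    simp only [hU]
    congr 1
    refine intervalIntegral.integral_congr_ae ?_
    filter_upwards [hd] with t ht _
    exact ht
  have hY' : Y = fun x => d + ∫ t in (0 : ℝ)..x, q t * U t := by
    funext x
    simp only [hY]
    congr 1
    refine intervalIntegral.integral_congr_ae ?_
    filter_upwards [hL.coeFn_toLp, hc] with t h1 h2 _
    rw [h1, h2]
  have cqU : Continuous fun t => q t * U t := hq.mul cU
  have dU : ∀ x, HasDerivAt U (Y x) x := fun x => by
    rw [hU']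
    exact (intervalIntegral.integral_hasDerivAt_right (cY.intervalIntegrable _ _)
      (cY.stronglyMeasurableAtFilter _ _) cY.continuousAt).const_add c
  have dY : ∀ x, HasDerivAt Y (q x * U x) x := fun x => by
    rw [hY']
    exact (intervalIntegral.integral_hasDerivAt_right (cqU.intervalIntegrable _ _)
      (cqU.stronglyMeasurableAtFilter _ _) cqU.continuousAt).const_add d
  have hve : ∀ᵐ x : ℝ, H1val (v : H1) (-x) = H1val (v : H1) x := v.2
  have hUe : ∀ x, U (-x) = U x := by
    have h1 := (Measure.measurePreserving_neg (volume : Measure ℝ)).quasiMeasurePreserving.ae hc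
    have h2 : (fun x => U (-x)) =ᵐ[volume] U := by
      filter_upwards [hc, h1, hve] with x a1 a2 a3
      change c + _ = c + _
      rw [← a1, ← a2, a3]
    exact fun x => congrFun ((Continuous.ae_eq_iff_eq volume (cU.comp continuous_neg) cU).1 h2) x
  have hY0 : Y 0 = 0 := by
    have h1 : HasDerivAt (fun x => U (-x)) (-Y 0) 0 := by
      have h2 : HasDerivAt U (Y 0) (-(0 : ℝ)) := by rw [neg_zero]; exact dU 0
      exact (h2.comp (0 : ℝ) (hasDerivAt_neg (0 : ℝ))).congr_deriv (by ring)
    have h3 : (fun x => U (-x)) = U := funext hUe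
    rw [h3] at h1
    linarith [h1.unique (dU 0)]
  -- The Wronskian is constant, and integrable as a sum of products of `L²` functions, hence zero.
  -- At `0`, where `P` vanishes and `Q` does not, this forces `U 0 = 0`; evenness gives `Y 0 = 0`,
  -- so the Cauchy data are zero.
  set Wr : ℝ → ℝ := fun x => Y x * P x - U x * Q x with hWr
  have dWr : ∀ x, HasDerivAt Wr 0 x := fun x => by
    refine (((dY x).mul (hP x)).sub ((dU x).mul (hQ x))).congr_deriv ?_
    ring
  have hconst : ∀ x, Wr x = Wr 0 := fun x =>
    is_const_of_deriv_eq_zero (fun x => (dWr x).differentiableAt) (fun x => (dWr x).deriv) x 0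
  have hint : Integrable Wr := by
    have i1 := (H1.memLp_grad (v : H1)).integrable_mul hP2
    have i2 := (H1.memLp_val (v : H1)).integrable_mul hQ2
    refine (i1.sub i2).congr ?_
    filter_upwards [hc, hd] with x a1 a2
    simp only [Pi.sub_apply, Pi.mul_apply, hWr]
    rw [a1, a2]
  have hW0 : Wr 0 = 0 := by
    have h1 : Wr = fun _ => Wr 0 := funext hconst
    rw [h1, integrable_const_iff] at hint
    rcases hint with h | h
    · exact h
    · exact absurd h.measure_univ_lt_top (by simp)
  have hU0 : U 0 = 0 := by
    simp only [hWr, hP0, mul_zero, zero_sub, neg_eq_zero, mul_eq_zero] at hW0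
    exact hW0.resolve_right hQ0
  have hB0 : 0 ≤ B := (abs_nonneg _).trans (hB 0)
  have hzero : (fun x => (U x, Y x)) = fun _ => (0 : ℝ × ℝ) := by
    refine ODE_solution_unique_univ (v := fun t p => (p.2, q t * p.1)) (s := fun _ => univ)
      (K := Real.toNNReal (max 1 B)) (t₀ := 0) ?_ ?_ ?_ ?_
    · intro t
      refine LipschitzOnWith.of_dist_le_mul fun x _ y _ => ?_
      rw [Prod.dist_eq, Prod.dist_eq, Real.coe_toNNReal _ (le_max_of_le_left zero_le_one)]
      refine max_le ?_ ?_
      · calc dist x.2 y.2 ≤ 1 * max (dist x.1 y.1) (dist x.2 y.2) := by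
              rw [one_mul]; exact le_max_right _ _
          _ ≤ _ := by gcongr; exact le_max_left _ _
      · rw [Real.dist_eq, ← mul_sub, abs_mul, ← Real.dist_eq]
        exact mul_le_mul ((hB t).trans (le_max_right _ _)) (le_max_left _ _) dist_nonneg
          (le_max_of_le_left zero_le_one)
    · exact fun t => ⟨(dU t).prodMk (dY t), mem_univ _⟩
    · intro t
      refine ⟨?_, mem_univ _⟩
      exact (hasDerivAt_const t (0 : ℝ × ℝ)).congr_deriv (by simp; rfl)
    · simp [hU0, hY0]
  refine Subtype.ext (H1.ext_val ?_ ?_)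
  · refine Lp.ext ?_
    filter_upwards [hc, Lp.coeFn_zero ℝ 2 (volume : Measure ℝ)] with x h1 h2
    have h3 : U x = 0 := congrArg Prod.fst (congrFun hzero x)
    rw [h1]
    exact h3.trans h2.symm
  · refine Lp.ext ?_
    filter_upwards [hd, Lp.coeFn_zero ℝ 2 (volume : Measure ℝ)] with x h1 h2
    have h3 : Y x = 0 := congrArg Prod.snd (congrFun hzero x)
    rw [h1]
    exact h3.trans h2.symm

end Kernel

/-! ### The explicit profile -/

/-- `√(a² - 2 b k)`. -/
def rootDisc (a b k : ℝ) : ℝ := √(a ^ 2 - 2 * b * k)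

/-- The reciprocal of the square of the profile, `y = R⁻²`, for `k = m² - ω²`. -/
def invSq (a b k x : ℝ) : ℝ := (a + rootDisc a b k * Real.cosh (2 * √k * x)) / k

/-- The derivative of `y` in `x`. -/
def invSqDx (a b k x : ℝ) : ℝ := rootDisc a b k * (Real.sinh (2 * √k * x) * (2 * √k)) / k

/-- The derivative of `y` in `k`. -/
def invSqDk (a b k x : ℝ) : ℝ :=
  (-invSq a b k x - b / rootDisc a b k * Real.cosh (2 * √k * x) +
    rootDisc a b k * (1 / √k) * x * Real.sinh (2 * √k * x)) / k

/-- The mixed derivative of `y`. -/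
def invSqDkDx (a b k x : ℝ) : ℝ :=
  (-invSqDx a b k x - b / rootDisc a b k * (2 * √k) * Real.sinh (2 * √k * x) +
    rootDisc a b k * (1 / √k) * Real.sinh (2 * √k * x) +
    2 * rootDisc a b k * x * Real.cosh (2 * √k * x)) / k

/-- The parameters for which the profile exists. -/
structure Admissible (a b k : ℝ) : Prop where
  a_pos : 0 < a
  b_pos : 0 < b
  k_pos : 0 < k
  disc_pos : 0 < a ^ 2 - 2 * b * k

theorem hasDerivAt_two_sqrt_mul (k x : ℝ) : HasDerivAt (fun x : ℝ => 2 * √k * x) (2 * √k) x := by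
  simpa using (hasDerivAt_id x).const_mul (2 * √k)

theorem hasDerivAt_invSq (a b k x : ℝ) : HasDerivAt (invSq a b k) (invSqDx a b k x) x :=
  (((hasDerivAt_two_sqrt_mul k x).cosh.const_mul _).const_add a).div_const k

namespace Admissible

variable {a b k : ℝ}

theorem rootDisc_pos (h : Admissible a b k) : 0 < rootDisc a b k := Real.sqrt_pos.2 h.disc_pos

theorem rootDisc_sq (h : Admissible a b k) : rootDisc a b k ^ 2 = a ^ 2 - 2 * b * k := Real.sq_sqrt h.disc_pos.le

theorem sqrt_pos (h : Admissible a b k) : 0 < √k := Real.sqrt_pos.2 h.k_pos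

theorem sqrt_sq (h : Admissible a b k) : √k ^ 2 = k := Real.sq_sqrt h.k_pos.le

theorem k_mul_invSq (h : Admissible a b k) (x : ℝ) :
    k * invSq a b k x = a + rootDisc a b k * Real.cosh (2 * √k * x) := by
  have := h.k_pos.ne'
  unfold invSq
  field_simp

theorem invSq_pos (h : Admissible a b k) (x : ℝ) : 0 < invSq a b k x := by
  have := h.k_pos
  have := h.a_pos
  have := h.rootDisc_pos
  have := Real.cosh_pos (2 * √k * x)
  unfold invSq
  positivity

/-- Source of the exponential decay: `y⁻¹` is bounded by a multiple of `1 / cosh(2√k x)`. -/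
theorem cosh_le (h : Admissible a b k) (x : ℝ) : rootDisc a b k * Real.cosh (2 * √k * x) ≤ k * invSq a b k x := by
  rw [h.k_mul_invSq]
  linarith [h.a_pos]

theorem sinh_le (h : Admissible a b k) (x : ℝ) : rootDisc a b k * |Real.sinh (2 * √k * x)| ≤ k * invSq a b k x := by
  refine le_trans ?_ (h.cosh_le x)
  have h1 : |Real.sinh (2 * √k * x)| ≤ Real.cosh (2 * √k * x) := by
    refine abs_le_of_sq_le_sq ?_ (Real.cosh_pos _).le
    rw [Real.cosh_sq]
    linarith
  exact mul_le_mul_of_nonneg_left h1 h.rootDisc_pos.le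

theorem hasDerivAt_invSqDx (h : Admissible a b k) (x : ℝ) :
    HasDerivAt (invSqDx a b k) (4 * (k * invSq a b k x - a)) x := by
  refine ((((hasDerivAt_two_sqrt_mul k x).sinh.mul_const (2 * √k)).const_mul
    (rootDisc a b k)).div_const k).congr_deriv ?_
  rw [h.k_mul_invSq]
  have h1 := h.sqrt_sq
  have := h.k_pos.ne'
  field_simp
  rw [h1]
  ring

/-- The first integral of `y'' = 4(ky - a)`; its constant comes from `cosh² - sinh² = 1` and `D² =
a² - 2bk`. -/
theorem invSqDx_sq (h : Admissible a b k) (x : ℝ) : invSqDx a b k x ^ 2 =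
    4 * (k * invSq a b k x ^ 2 - 2 * a * invSq a b k x + 2 * b) := by
  have h1 := h.sqrt_sq
  have h2 := h.rootDisc_sq
  have h3 := Real.cosh_sq (2 * √k * x)
  have hk := h.k_pos.ne'
  unfold invSqDx invSq
  field_simp
  linear_combination (4 * rootDisc a b k ^ 2 * Real.sinh (2 * √k * x) ^ 2) * h1 -
    4 * k * rootDisc a b k ^ 2 * h3 - 4 * k * h2

theorem hasDerivAt_invSqDk (h : Admissible a b k) (x : ℝ) : HasDerivAt (invSqDk a b k) (invSqDkDx a b k x) x := by
  have hs := hasDerivAt_two_sqrt_mul k x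
  have h1 := ((hasDerivAt_invSq a b k x).neg.sub (hs.cosh.const_mul (b / rootDisc a b k))).add
    (((hasDerivAt_id x).const_mul (rootDisc a b k * (1 / √k))).mul hs.sinh)
  refine (h1.div_const k).congr_deriv ?_
  have := h.sqrt_pos.ne'
  unfold invSqDkDx
  congr 1
  simp only [id]
  field_simp
  ring

/-- The `k`-derivative of `y'' = 4(ky - a)`, checked on the closed formula so that no exchange of
derivatives has to be justified. -/
theorem hasDerivAt_invSqDkDx (h : Admissible a b k) (x : ℝ) :
    HasDerivAt (invSqDkDx a b k) (4 * k * invSqDk a b k x + 4 * invSq a b k x) x := by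
  have hs := hasDerivAt_two_sqrt_mul k x
  have h1 := (((h.hasDerivAt_invSqDx x).neg.sub
    (hs.sinh.const_mul (b / rootDisc a b k * (2 * √k)))).add
    (hs.sinh.const_mul (rootDisc a b k * (1 / √k)))).add
    (((hasDerivAt_id x).const_mul (2 * rootDisc a b k)).mul hs.cosh)
  refine (h1.div_const k).congr_deriv ?_
  have hy := h.k_mul_invSq x
  have hq := h.sqrt_sq
  have h2 := h.sqrt_pos.ne'
  have h3 := h.k_pos.ne'
  have h4 := h.rootDisc_pos.ne'
  have e1 : b / rootDisc a b k * (2 * √k) * (Real.cosh (2 * √k * x) * (2 * √k)) =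
      4 * k * (b / rootDisc a b k * Real.cosh (2 * √k * x)) := by
    calc _ = 4 * √k ^ 2 * (b / rootDisc a b k * Real.cosh (2 * √k * x)) := by ring
      _ = _ := by rw [hq]
  have e2 : rootDisc a b k * (1 / √k) * (Real.cosh (2 * √k * x) * (2 * √k)) =
      2 * (rootDisc a b k * Real.cosh (2 * √k * x)) := by
    field_simp
  have e3 : 2 * rootDisc a b k * x * (Real.sinh (2 * √k * x) * (2 * √k)) =
      4 * k * (rootDisc a b k * (1 / √k) * x * Real.sinh (2 * √k * x)) := by
    calc _ = 4 * √k ^ 2 * (rootDisc a b k * (1 / √k) * x * Real.sinh (2 * √k * x)) := by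
          field_simp
          ring
      _ = _ := by rw [hq]
  simp only [id]
  rw [e1, e2, e3]
  unfold invSqDk
  rw [div_eq_iff h3]
  have e4 : ∀ A : ℝ, 4 * k * (A / k) = 4 * A := fun A => by field_simp
  rw [e4]
  linear_combination (-4 : ℝ) * hy

/-- Half the `k`-derivative of the first integral `invSqDx_sq`. -/
theorem invSqDx_mul_invSqDkDx (h : Admissible a b k) (x : ℝ) : invSqDx a b k x * invSqDkDx a b k x =
    2 * (invSq a b k x ^ 2 + 2 * k * invSq a b k x * invSqDk a b k x -
      2 * a * invSqDk a b k x) := by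
  have hq := h.sqrt_sq
  have h2 := h.sqrt_pos.ne'
  have h3 := h.k_pos.ne'
  have h4 := h.rootDisc_pos.ne'
  have hD := h.rootDisc_sq
  have hc := Real.cosh_sq (2 * √k * x)
  unfold invSqDkDx invSqDk invSqDx invSq
  generalize Real.cosh (2 * √k * x) = C at *
  generalize Real.sinh (2 * √k * x) = S at *
  generalize rootDisc a b k = D at *
  generalize √k = r at *
  subst hq
  field_simp
  linear_combination D * (D ^ 2 + 2 * r ^ 2 * b) * hc + D * hD

theorem abs_invSqDx_le (h : Admissible a b k) (x : ℝ) : |invSqDx a b k x| ≤ 2 * √k * invSq a b k x := by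
  have h1 := h.sinh_le x
  have hk := h.k_pos
  have hr := h.sqrt_pos
  unfold invSqDx
  rw [abs_div, abs_of_pos hk, div_le_iff₀ hk, abs_mul, abs_mul, abs_of_pos h.rootDisc_pos,
    abs_of_pos (by positivity : 0 < 2 * √k)]
  nlinarith

end Admissible

/-! ### Decay estimates, and differentiation of the mass in `k`. -/

/-- Quartic growth suffices: it absorbs a weight `(1 + |x|)²` and still leaves the integrable `1/(1
+ x²)`. -/
theorem sq_le_two_mul_cosh (t : ℝ) : (1 + t ^ 2 / 8) ^ 2 ≤ 2 * Real.cosh t := by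
  have h1 : Real.exp |t| ≤ 2 * Real.cosh t := by
    rw [← Real.cosh_abs, Real.cosh_eq]
    linarith [Real.exp_pos (-|t|)]
  have h2 : 1 + |t| / 2 + (|t| / 2) ^ 2 / 2 ≤ Real.exp (|t| / 2) :=
    Real.quadratic_le_exp_of_nonneg (by positivity)
  have h3 : 1 + t ^ 2 / 8 ≤ Real.exp (|t| / 2) := by
    have := sq_abs t
    have := abs_nonneg t
    nlinarith
  calc (1 + t ^ 2 / 8) ^ 2 ≤ Real.exp (|t| / 2) ^ 2 := by gcongr
    _ = Real.exp |t| := by rw [← Real.exp_nat_mul]; congr 1; push_cast; ring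
    _ ≤ _ := h1

theorem integrable_sq_div_cosh {c : ℝ} (hc : 0 < c) :
    Integrable fun x : ℝ => (1 + |x|) ^ 2 / Real.cosh (c * x) := by
  -- Chosen so that `δ(1 + x²) ≤ 1 + (cx)²/8`.
  set δ := min 1 (c ^ 2 / 8)
  have hδ : 0 < δ := by positivity
  refine (integrable_inv_one_add_sq.const_mul (4 / δ ^ 2)).mono' ?_ (Eventually.of_forall fun x => ?_)
  · refine Continuous.aestronglyMeasurable ?_
    have : Continuous fun x : ℝ => Real.cosh (c * x) :=
      Real.continuous_cosh.comp (continuous_const.mul continuous_id)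
    exact ((continuous_const.add continuous_abs).pow 2).div this fun x => (Real.cosh_pos _).ne'
  · rw [Real.norm_of_nonneg (div_nonneg (sq_nonneg _) (Real.cosh_pos _).le)]
    have hC := Real.cosh_pos (c * x)
    have h1 := sq_le_two_mul_cosh (c * x)
    have h2 : δ * (1 + x ^ 2) ≤ 1 + (c * x) ^ 2 / 8 := by
      have a1 : δ ≤ 1 := min_le_left _ _
      have a2 : δ * x ^ 2 ≤ c ^ 2 / 8 * x ^ 2 :=
        mul_le_mul_of_nonneg_right (min_le_right _ _) (sq_nonneg x)
      nlinarith
    have h3 : (δ * (1 + x ^ 2)) ^ 2 ≤ 2 * Real.cosh (c * x) :=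
      (pow_le_pow_left₀ (by positivity) h2 2).trans h1
    have h4 : (1 + |x|) ^ 2 ≤ 2 * (1 + x ^ 2) := by
      have := sq_abs x
      nlinarith [sq_nonneg (1 - |x|)]
    rw [div_le_iff₀ hC]
    have hx : 0 < 1 + x ^ 2 := by positivity
    calc (1 + |x|) ^ 2 ≤ 2 * (1 + x ^ 2) := h4
      _ = 2 / δ ^ 2 * (1 + x ^ 2)⁻¹ * (δ * (1 + x ^ 2)) ^ 2 := by field_simp
      _ ≤ 2 / δ ^ 2 * (1 + x ^ 2)⁻¹ * (2 * Real.cosh (c * x)) := by gcongr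
      _ = _ := by ring

theorem integrable_div_cosh {c : ℝ} (hc : 0 < c) :
    Integrable fun x : ℝ => (1 + |x|) / Real.cosh (c * x) := by
  refine (integrable_sq_div_cosh hc).mono' ?_ (Eventually.of_forall fun x => ?_)
  · refine Continuous.aestronglyMeasurable ?_
    have : Continuous fun x : ℝ => Real.cosh (c * x) :=
      Real.continuous_cosh.comp (continuous_const.mul continuous_id)
    exact (continuous_const.add continuous_abs).div this fun x => (Real.cosh_pos _).ne'
  · have hC := Real.cosh_pos (c * x)
    rw [Real.norm_of_nonneg (by positivity)]
    gcongr
    nlinarith [abs_nonneg x]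

namespace Admissible

variable {a b k : ℝ}

theorem inv_invSq_le (h : Admissible a b k) (x : ℝ) :
    (invSq a b k x)⁻¹ ≤ k / rootDisc a b k / Real.cosh (2 * √k * x) := by
  have hD := h.rootDisc_pos
  have hC := Real.cosh_pos (2 * √k * x)
  have hy := h.invSq_pos x
  rw [div_div, inv_eq_one_div, div_le_div_iff₀ hy (by positivity)]
  linarith [h.cosh_le x]

/-- Differentiating in `k` costs only a factor `1 + |x|`, which comes from the argument `2√k x`; the
hyperbolic functions are absorbed by `y`. -/
theorem abs_invSqDk_le (h : Admissible a b k) (x : ℝ) : |invSqDk a b k x| ≤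
    (1 / k + b / rootDisc a b k ^ 2 + 1 / √k) * (1 + |x|) * invSq a b k x := by
  have hk := h.k_pos
  have hb := h.b_pos
  have hr := h.sqrt_pos
  have hD := h.rootDisc_pos
  have hC := Real.cosh_pos (2 * √k * x)
  have hy := h.invSq_pos x
  have hc := h.cosh_le x
  have hs := h.sinh_le x
  have hx := abs_nonneg x
  set y := invSq a b k x
  have e1 : |b / rootDisc a b k * Real.cosh (2 * √k * x)| ≤
      b / rootDisc a b k ^ 2 * (k * y) := by
    rw [abs_of_pos (by positivity)]
    calc _ = b / rootDisc a b k ^ 2 * (rootDisc a b k * Real.cosh (2 * √k * x)) := by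
          field_simp
      _ ≤ _ := by gcongr
  have e2 : |rootDisc a b k * (1 / √k) * x * Real.sinh (2 * √k * x)| ≤
      1 / √k * |x| * (k * y) := by
    rw [abs_mul, abs_mul, abs_mul, abs_of_pos hD, abs_of_pos (by positivity : 0 < 1 / √k)]
    calc _ = 1 / √k * |x| * (rootDisc a b k * |Real.sinh (2 * √k * x)|) := by ring
      _ ≤ _ := by gcongr
  unfold invSqDk
  rw [abs_div, abs_of_pos hk, div_le_iff₀ hk]
  calc _ ≤ y + b / rootDisc a b k ^ 2 * (k * y) + 1 / √k * |x| * (k * y) := by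
        refine (abs_add_le _ _).trans (add_le_add ((abs_sub _ _).trans (add_le_add ?_ e1)) e2)
        rw [abs_neg, abs_of_pos hy]
    _ = (1 / k + b / rootDisc a b k ^ 2 + 1 / √k * |x|) * y * k := by field_simp
    _ ≤ (1 / k * (1 + |x|) + b / rootDisc a b k ^ 2 * (1 + |x|) + 1 / √k * (1 + |x|)) * y * k := by
        gcongr
        · exact le_mul_of_one_le_right (by positivity) (by linarith)
        · exact le_mul_of_one_le_right (by positivity) (by linarith)
        · linarith
    _ = _ := by ring

theorem abs_invSqDkDx_le (h : Admissible a b k) (x : ℝ) : |invSqDkDx a b k x| ≤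
    (2 * √k / k + b / rootDisc a b k ^ 2 * (2 * √k) + 1 / √k + 2) * (1 + |x|) *
      invSq a b k x := by
  have hk := h.k_pos
  have hb := h.b_pos
  have hr := h.sqrt_pos
  have hD := h.rootDisc_pos
  have hC := Real.cosh_pos (2 * √k * x)
  have hy := h.invSq_pos x
  have hc := h.cosh_le x
  have hs := h.sinh_le x
  have hx := abs_nonneg x
  have e0 := h.abs_invSqDx_le x
  set y := invSq a b k x
  have e1 : |b / rootDisc a b k * (2 * √k) * Real.sinh (2 * √k * x)| ≤
      b / rootDisc a b k ^ 2 * (2 * √k) * (k * y) := by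
    rw [abs_mul, abs_of_pos (by positivity)]
    calc _ = b / rootDisc a b k ^ 2 * (2 * √k) *
          (rootDisc a b k * |Real.sinh (2 * √k * x)|) := by field_simp
      _ ≤ _ := by gcongr
  have e2 : |rootDisc a b k * (1 / √k) * Real.sinh (2 * √k * x)| ≤ 1 / √k * (k * y) := by
    rw [abs_mul, abs_mul, abs_of_pos hD, abs_of_pos (by positivity : 0 < 1 / √k)]
    calc _ = 1 / √k * (rootDisc a b k * |Real.sinh (2 * √k * x)|) := by ring
      _ ≤ _ := by gcongr
  have e3 : |2 * rootDisc a b k * x * Real.cosh (2 * √k * x)| ≤ 2 * |x| * (k * y) := by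
    rw [abs_mul, abs_mul, abs_of_pos (by positivity : 0 < 2 * rootDisc a b k), abs_of_pos hC]
    calc _ = 2 * |x| * (rootDisc a b k * Real.cosh (2 * √k * x)) := by ring
      _ ≤ _ := by gcongr
  unfold invSqDkDx
  rw [abs_div, abs_of_pos hk, div_le_iff₀ hk]
  calc _ ≤ 2 * √k * y + b / rootDisc a b k ^ 2 * (2 * √k) * (k * y) + 1 / √k * (k * y) +
        2 * |x| * (k * y) := by
        refine (abs_add_le _ _).trans (add_le_add ((abs_add_le _ _).trans
          (add_le_add ((abs_sub _ _).trans (add_le_add ?_ e1)) e2)) e3)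
        rw [abs_neg]
        exact e0
    _ = (2 * √k / k + b / rootDisc a b k ^ 2 * (2 * √k) + 1 / √k + 2 * |x|) * y * k := by
        field_simp
    _ ≤ (2 * √k / k * (1 + |x|) + b / rootDisc a b k ^ 2 * (2 * √k) * (1 + |x|) +
          1 / √k * (1 + |x|) + 2 * (1 + |x|)) * y * k := by
        have hge : ∀ A : ℝ, 0 ≤ A → A ≤ A * (1 + |x|) := fun A hA =>
          le_mul_of_one_le_right hA (by linarith)
        have g1 := hge (2 * √k / k) (by positivity)
        have g2 := hge (b / rootDisc a b k ^ 2 * (2 * √k)) (by positivity)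
        have g3 := hge (1 / √k) (by positivity)
        refine mul_le_mul_of_nonneg_right (mul_le_mul_of_nonneg_right ?_ hy.le) hk.le
        linarith
    _ = _ := by ring

theorem hasDerivAt_invSq_param (h : Admissible a b k) (x : ℝ) :
    HasDerivAt (fun k => invSq a b k x) (invSqDk a b k x) k := by
  have hk := h.k_pos
  have hr := h.sqrt_pos
  have hD := h.rootDisc_pos
  have d1 : HasDerivAt (fun k => 2 * √k * x) (2 * (1 / (2 * √k)) * x) k :=
    ((Real.hasDerivAt_sqrt hk.ne').const_mul 2).mul_const x
  have d2 : HasDerivAt (fun k => a ^ 2 - 2 * b * k) (-(2 * b)) k := by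
    simpa using ((hasDerivAt_id k).const_mul (2 * b)).const_sub (a ^ 2)
  have d3 : HasDerivAt (fun k => rootDisc a b k) (-(2 * b) / (2 * rootDisc a b k)) k :=
    d2.sqrt h.disc_pos.ne'
  have d4 := ((d3.mul d1.cosh).const_add a).div (hasDerivAt_id k) hk.ne'
  refine d4.congr_deriv ?_
  unfold invSqDk invSq
  simp only [id, Pi.mul_apply]
  field_simp
  ring

theorem eventually (h : Admissible a b k) : ∀ᶠ l in 𝓝 k, Admissible a b l := by
  have h1 : Continuous fun l : ℝ => a ^ 2 - 2 * b * l := by fun_prop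
  filter_upwards [Ioi_mem_nhds h.k_pos,
    h1.continuousAt.eventually_mem (Ioi_mem_nhds h.disc_pos)] with l a1 a2
  exact ⟨h.a_pos, h.b_pos, a1, a2⟩

theorem continuous_invSq (a b k : ℝ) : Continuous (invSq a b k) :=
  continuous_iff_continuousAt.2 fun x => (hasDerivAt_invSq a b k x).continuousAt

theorem continuous_inv_invSq (h : Admissible a b k) : Continuous fun x => (invSq a b k x)⁻¹ :=
  (continuous_invSq a b k).inv₀ fun x => (h.invSq_pos x).ne'

theorem integrable_sq_mul_inv_invSq (h : Admissible a b k) :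
    Integrable fun x => (1 + |x|) ^ 2 * (invSq a b k x)⁻¹ := by
  have hr := h.sqrt_pos
  refine ((integrable_sq_div_cosh (by positivity : 0 < 2 * √k)).const_mul
    (k / rootDisc a b k)).mono' ?_ (Eventually.of_forall fun x => ?_)
  · exact (((continuous_const.add continuous_abs).pow 2).mul
      h.continuous_inv_invSq).aestronglyMeasurable
  · have hy := h.invSq_pos x
    rw [Real.norm_of_nonneg (by positivity)]
    calc _ ≤ (1 + |x|) ^ 2 * (k / rootDisc a b k / Real.cosh (2 * √k * x)) := by
          gcongr
          exact h.inv_invSq_le x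
      _ = _ := by ring

theorem integrable_inv_invSq (h : Admissible a b k) : Integrable fun x => (invSq a b k x)⁻¹ := by
  refine h.integrable_sq_mul_inv_invSq.mono' h.continuous_inv_invSq.aestronglyMeasurable
    (Eventually.of_forall fun x => ?_)
  have hy := h.invSq_pos x
  rw [Real.norm_of_nonneg (by positivity)]
  refine le_mul_of_one_le_left (by positivity) ?_
  nlinarith [abs_nonneg x]

/-- Differentiation of the mass of the profile in the parameter. -/
theorem hasDerivAt_integral_inv_invSq (h : Admissible a b k) :
    HasDerivAt (fun k => ∫ x, (invSq a b k x)⁻¹)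
      (∫ x, -invSqDk a b k x / invSq a b k x ^ 2) k := by
  have hk := h.k_pos
  have hb := h.b_pos
  have hD := h.rootDisc_pos
  have hDc : Continuous fun l : ℝ => rootDisc a b l := by
    unfold rootDisc
    fun_prop
  -- Lower bounds for `rootDisc a b l` and `l`, valid for all `l` near `k`. They give one dominating
  -- function, with the slower rate `2√k₁`.
  set D₁ := rootDisc a b k / 2 with hD₁
  set k₁ := k / 2 with hk₁
  have hD₁p : 0 < D₁ := by positivity
  have hk₁p : 0 < k₁ := by positivity
  have hr₁ : 0 < √k₁ := Real.sqrt_pos.2 hk₁p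
  have hev : ∀ᶠ l in 𝓝 k, Admissible a b l ∧ k₁ < l ∧ l < 2 * k ∧ D₁ < rootDisc a b l := by
    filter_upwards [h.eventually, Ioo_mem_nhds (by linarith : k₁ < k) (by linarith : k < 2 * k),
      hDc.continuousAt.eventually_mem (Ioi_mem_nhds (by linarith : D₁ < rootDisc a b k))]
      with l a1 a2 a3
    exact ⟨a1, a2.1, a2.2, a3⟩
  set K := (1 / k₁ + b / D₁ ^ 2 + 1 / √k₁) * (2 * k / D₁) with hK
  refine (hasDerivAt_integral_of_dominated_loc_of_deriv_le (s := {l | Admissible a b l ∧ k₁ < l ∧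
    l < 2 * k ∧ D₁ < rootDisc a b l}) (bound := fun x => K * ((1 + |x|) / Real.cosh (2 * √k₁ * x)))
    (F := fun l x => (invSq a b l x)⁻¹)
    (F' := fun l x => -invSqDk a b l x / invSq a b l x ^ 2) hev ?_ h.integrable_inv_invSq ?_ ?_
    ((integrable_div_cosh (by positivity)).const_mul _) ?_).2
  · filter_upwards [h.eventually] with l hl
    exact hl.continuous_inv_invSq.aestronglyMeasurable
  · have hc : Continuous (invSqDk a b k) :=
      continuous_iff_continuousAt.2 fun x => (h.hasDerivAt_invSqDk x).continuousAt
    exact (hc.neg.div ((continuous_invSq a b k).pow 2)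
      fun x => (pow_pos (h.invSq_pos x) 2).ne').aestronglyMeasurable
  · refine Eventually.of_forall fun x l hl => ?_
    obtain ⟨hl, l1, l2, l3⟩ := hl
    have hy := hl.invSq_pos x
    have hx := abs_nonneg x
    have hlp := hl.k_pos
    have hC := Real.cosh_pos (2 * √k₁ * x)
    have hC' := Real.cosh_pos (2 * √l * x)
    have hDl := hl.rootDisc_pos
    have hsq : √k₁ ≤ √l := Real.sqrt_le_sqrt l1.le
    rw [norm_div, norm_neg, norm_pow, Real.norm_eq_abs, Real.norm_of_nonneg hy.le]
    have e1 := hl.abs_invSqDk_le x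
    have e2 := hl.inv_invSq_le x
    have hle : Real.cosh (2 * √k₁ * x) ≤ Real.cosh (2 * √l * x) := by
      rw [Real.cosh_le_cosh, abs_mul, abs_mul (2 * √l), abs_of_pos (by positivity : 0 < 2 * √k₁),
        abs_of_nonneg (by positivity : 0 ≤ 2 * √l)]
      gcongr
    calc |invSqDk a b l x| / invSq a b l x ^ 2
        ≤ (1 / l + b / rootDisc a b l ^ 2 + 1 / √l) * (1 + |x|) * invSq a b l x /
          invSq a b l x ^ 2 := by gcongr
      _ = (1 / l + b / rootDisc a b l ^ 2 + 1 / √l) * (1 + |x|) * (invSq a b l x)⁻¹ := by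
          field_simp
      _ ≤ (1 / l + b / rootDisc a b l ^ 2 + 1 / √l) * (1 + |x|) *
          (l / rootDisc a b l / Real.cosh (2 * √l * x)) := by
          gcongr
      _ ≤ (1 / k₁ + b / D₁ ^ 2 + 1 / √k₁) * (1 + |x|) *
          (2 * k / D₁ / Real.cosh (2 * √k₁ * x)) := by
          gcongr
      _ = _ := by rw [hK]; ring
  · refine Eventually.of_forall fun x l hl => ?_
    exact (hl.1.hasDerivAt_invSq_param x).inv (hl.1.invSq_pos x).ne'

end Admissible

/-! ### The profile `R = y^(-1/2)` and its `k`-derivative: differential equations and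
square-integrability. -/

/-- The profile as an explicit function of `k = m² - ω²`. -/
def bump (a b k x : ℝ) : ℝ := 1 / √(invSq a b k x)

/-- The derivative of the profile. -/
def bumpDx (a b k x : ℝ) : ℝ := -(1 / 2) * invSqDx a b k x * bump a b k x ^ 3

/-- The derivative of the profile in the parameter `k`. -/
def bumpDk (a b k x : ℝ) : ℝ := -(1 / 2) * invSqDk a b k x * bump a b k x ^ 3

/-- The mixed derivative of the profile. -/
def bumpDkDx (a b k x : ℝ) : ℝ :=
  -(1 / 2) * (invSqDkDx a b k x * bump a b k x ^ 3 +
    invSqDk a b k x * (3 * bump a b k x ^ 2 * bumpDx a b k x))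

namespace Admissible

variable {a b k : ℝ}

theorem bump_pos (h : Admissible a b k) (x : ℝ) : 0 < bump a b k x := by
  have := Real.sqrt_pos.2 (h.invSq_pos x)
  unfold bump
  positivity

theorem bump_sq (h : Admissible a b k) (x : ℝ) : bump a b k x ^ 2 = (invSq a b k x)⁻¹ := by
  unfold bump
  rw [div_pow, Real.sq_sqrt (h.invSq_pos x).le, one_pow, one_div]

theorem bump_sq_mul (h : Admissible a b k) (x : ℝ) : bump a b k x ^ 2 * invSq a b k x = 1 := by
  rw [h.bump_sq, inv_mul_cancel₀ (h.invSq_pos x).ne']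

theorem hasDerivAt_bump (h : Admissible a b k) (x : ℝ) :
    HasDerivAt (bump a b k) (bumpDx a b k x) x := by
  have hs := Real.sqrt_pos.2 (h.invSq_pos x)
  have h1 := ((hasDerivAt_invSq a b k x).sqrt (h.invSq_pos x).ne').inv hs.ne'
  have e : bump a b k = (fun x => √(invSq a b k x))⁻¹ := by
    funext z
    simp [bump]
  rw [e]
  refine h1.congr_deriv ?_
  unfold bumpDx bump
  field_simp

/-- From `R = y^(-1/2)`, `R'' = ¾ y'² R⁵ - ½ y'' R³`. The first integral removes `y'²`, and `R² y =
1` then removes `y`. -/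
theorem hasDerivAt_bumpDx (h : Admissible a b k) (x : ℝ) : HasDerivAt (bumpDx a b k)
    (-4 * a * bump a b k x ^ 3 + 6 * b * bump a b k x ^ 5 + k * bump a b k x) x := by
  have h1 := ((h.hasDerivAt_invSqDx x).const_mul (-(1 / 2))).mul ((h.hasDerivAt_bump x).pow 3)
  refine h1.congr_deriv ?_
  have e2 := h.invSqDx_sq x
  have hy1 := h.bump_sq_mul x
  simp only [Pi.pow_apply, bumpDx]
  generalize bump a b k x = r at *
  generalize invSq a b k x = y at *
  generalize invSqDx a b k x = y' at *
  have t1 : r ^ 5 * y ^ 2 = r := by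
    rw [show r ^ 5 * y ^ 2 = r * (r ^ 2 * y) ^ 2 by ring, hy1]; ring
  have t2 : r ^ 5 * y = r ^ 3 := by
    rw [show r ^ 5 * y = r ^ 3 * (r ^ 2 * y) by ring, hy1]; ring
  have t3 : r ^ 3 * y = r := by
    rw [show r ^ 3 * y = r * (r ^ 2 * y) by ring, hy1]; ring
  push_cast
  linear_combination 3 / 4 * r ^ 5 * e2 + 3 * k * t1 - 6 * a * t2 - 2 * k * t3

theorem hasDerivAt_bumpDk (h : Admissible a b k) (x : ℝ) :
    HasDerivAt (bumpDk a b k) (bumpDkDx a b k x) x := by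
  have h1 := ((h.hasDerivAt_invSqDk x).const_mul (-(1 / 2))).mul ((h.hasDerivAt_bump x).pow 3)
  refine h1.congr_deriv ?_
  simp only [Pi.pow_apply, bumpDkDx]
  push_cast
  ring

/-- The linearised equation for the derivative of the profile in the parameter. -/
theorem hasDerivAt_bumpDkDx (h : Admissible a b k) (x : ℝ) : HasDerivAt (bumpDkDx a b k)
    ((k - 12 * a * bump a b k x ^ 2 + 30 * b * bump a b k x ^ 4) * bumpDk a b k x +
      bump a b k x) x := by
  have dR := h.hasDerivAt_bump x
  have h1 := (((h.hasDerivAt_invSqDkDx x).mul (dR.pow 3)).add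
    ((h.hasDerivAt_invSqDk x).mul (((dR.pow 2).const_mul 3).mul
      (h.hasDerivAt_bumpDx x)))).const_mul (-(1 / 2))
  refine h1.congr_deriv ?_
  have e2 := h.invSqDx_sq x
  have e3 := h.invSqDx_mul_invSqDkDx x
  have hy1 := h.bump_sq_mul x
  simp only [Pi.pow_apply, Pi.mul_apply, bumpDx, bumpDk]
  generalize bump a b k x = r at *
  generalize invSq a b k x = y at *
  generalize invSqDx a b k x = y' at *
  generalize invSqDk a b k x = z at *
  generalize invSqDkDx a b k x = z' at *
  have t1 : r ^ 5 * y ^ 2 = r := by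
    rw [show r ^ 5 * y ^ 2 = r * (r ^ 2 * y) ^ 2 by ring, hy1]; ring
  have t2 : r ^ 5 * y = r ^ 3 := by
    rw [show r ^ 5 * y = r ^ 3 * (r ^ 2 * y) by ring, hy1]; ring
  have t3 : r ^ 3 * y = r := by
    rw [show r ^ 3 * y = r * (r ^ 2 * y) by ring, hy1]; ring
  have t4 : r ^ 7 * y ^ 2 = r ^ 3 := by
    rw [show r ^ 7 * y ^ 2 = r ^ 3 * (r ^ 2 * y) ^ 2 by ring, hy1]; ring
  have t5 : r ^ 7 * y = r ^ 5 := by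
    rw [show r ^ 7 * y = r ^ 5 * (r ^ 2 * y) by ring, hy1]; ring
  push_cast
  linear_combination (-3 / 4 * r ^ 7 * z) * e2 + 3 / 2 * r ^ 5 * e3 + 6 * k * z * t2 - 3 * k * z * t4 +
    6 * a * z * t5 - 2 * t3 + 3 * t1

theorem continuous_bump (h : Admissible a b k) : Continuous (bump a b k) :=
  continuous_iff_continuousAt.2 fun x => (h.hasDerivAt_bump x).continuousAt

/-- The common majorant: `R`, `R'`, `∂_k R` and its `x`-derivative are all bounded by multiples of
`(1 + |x|) R`. -/
theorem memLp_weight_mul_bump (h : Admissible a b k) :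
    MemLp (fun x => (1 + |x|) * bump a b k x) 2 := by
  have hc : Continuous fun x : ℝ => (1 + |x|) * bump a b k x :=
    (continuous_const.add continuous_abs).mul h.continuous_bump
  rw [memLp_two_iff_integrable_sq hc.aestronglyMeasurable]
  refine h.integrable_sq_mul_inv_invSq.congr (Eventually.of_forall fun x => ?_)
  simp only
  rw [mul_pow, h.bump_sq]

theorem memLp_of_abs_le (h : Admissible a b k) {f : ℝ → ℝ} (hf : Continuous f) (K : ℝ)
    (hK : ∀ x, |f x| ≤ K * ((1 + |x|) * bump a b k x)) : MemLp f 2 := by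
  refine h.memLp_weight_mul_bump.of_le_mul (c := K) hf.aestronglyMeasurable
    (Eventually.of_forall fun x => ?_)
  have := h.bump_pos x
  rw [Real.norm_eq_abs, Real.norm_of_nonneg (by positivity)]
  exact hK x

theorem bump_le_weight (h : Admissible a b k) (x : ℝ) :
    bump a b k x ≤ (1 + |x|) * bump a b k x :=
  le_mul_of_one_le_left (h.bump_pos x).le (by linarith [abs_nonneg x])

theorem memLp_bump (h : Admissible a b k) : MemLp (bump a b k) 2 :=
  h.memLp_of_abs_le h.continuous_bump 1 fun x => by
    rw [abs_of_pos (h.bump_pos x), one_mul]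
    exact h.bump_le_weight x

theorem abs_bumpDx_le (h : Admissible a b k) (x : ℝ) :
    |bumpDx a b k x| ≤ √k * bump a b k x := by
  have hR := h.bump_pos x
  unfold bumpDx
  rw [abs_mul, abs_mul, abs_neg, abs_of_pos (by norm_num : (0 : ℝ) < 1 / 2),
    abs_of_pos (pow_pos hR 3)]
  calc _ ≤ 1 / 2 * (2 * √k * invSq a b k x) * bump a b k x ^ 3 := by
        gcongr
        exact h.abs_invSqDx_le x
    _ = √k * bump a b k x * (bump a b k x ^ 2 * invSq a b k x) := by ring
    _ = _ := by rw [h.bump_sq_mul, mul_one]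

theorem continuous_bumpDx (h : Admissible a b k) : Continuous (bumpDx a b k) :=
  continuous_iff_continuousAt.2 fun x => (h.hasDerivAt_bumpDx x).continuousAt

theorem memLp_bumpDx (h : Admissible a b k) : MemLp (bumpDx a b k) 2 :=
  h.memLp_of_abs_le h.continuous_bumpDx √k fun x =>
    (h.abs_bumpDx_le x).trans (mul_le_mul_of_nonneg_left (h.bump_le_weight x) (Real.sqrt_nonneg _))

theorem memLp_bumpDk (h : Admissible a b k) : MemLp (bumpDk a b k) 2 := by
  refine h.memLp_of_abs_le
    (continuous_iff_continuousAt.2 fun x => (h.hasDerivAt_bumpDk x).continuousAt)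
    (1 / 2 * (1 / k + b / rootDisc a b k ^ 2 + 1 / √k)) fun x => ?_
  have hR := h.bump_pos x
  unfold bumpDk
  rw [abs_mul, abs_mul, abs_neg, abs_of_pos (by norm_num : (0 : ℝ) < 1 / 2),
    abs_of_pos (pow_pos hR 3)]
  calc _ ≤ 1 / 2 * ((1 / k + b / rootDisc a b k ^ 2 + 1 / √k) * (1 + |x|) * invSq a b k x) *
        bump a b k x ^ 3 := by
        gcongr
        exact h.abs_invSqDk_le x
    _ = 1 / 2 * (1 / k + b / rootDisc a b k ^ 2 + 1 / √k) * ((1 + |x|) * bump a b k x) *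
        (bump a b k x ^ 2 * invSq a b k x) := by ring
    _ = _ := by rw [h.bump_sq_mul, mul_one]

theorem memLp_bumpDkDx (h : Admissible a b k) : MemLp (bumpDkDx a b k) 2 := by
  set A := 1 / k + b / rootDisc a b k ^ 2 + 1 / √k with hA
  set A' := 2 * √k / k + b / rootDisc a b k ^ 2 * (2 * √k) + 1 / √k + 2 with hA'
  refine h.memLp_of_abs_le
    (continuous_iff_continuousAt.2 fun x => (h.hasDerivAt_bumpDkDx x).continuousAt)
    (1 / 2 * (A' + 3 * A * √k)) fun x => ?_
  have hR := h.bump_pos x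
  have hy := h.invSq_pos x
  have hk := h.k_pos
  have hb := h.b_pos
  have hx := abs_nonneg x
  have hA0 : 0 ≤ A := by positivity
  have e1 := h.abs_invSqDk_le x
  have e2 := h.abs_invSqDkDx_le x
  have e3 := h.abs_bumpDx_le x
  unfold bumpDkDx
  rw [abs_mul, abs_neg, abs_of_pos (by norm_num : (0 : ℝ) < 1 / 2)]
  calc _ ≤ 1 / 2 * (|invSqDkDx a b k x * bump a b k x ^ 3| +
        |invSqDk a b k x * (3 * bump a b k x ^ 2 * bumpDx a b k x)|) := by
        gcongr
        exact abs_add_le _ _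
    _ = 1 / 2 * (|invSqDkDx a b k x| * bump a b k x ^ 3 +
        |invSqDk a b k x| * (3 * bump a b k x ^ 2 * |bumpDx a b k x|)) := by
        rw [abs_mul, abs_mul, abs_mul, abs_of_pos (pow_pos hR 3),
          abs_of_pos (by positivity : 0 < 3 * bump a b k x ^ 2)]
    _ ≤ 1 / 2 * (A' * (1 + |x|) * invSq a b k x * bump a b k x ^ 3 +
        A * (1 + |x|) * invSq a b k x * (3 * bump a b k x ^ 2 * (√k * bump a b k x))) := by
        gcongr
    _ = 1 / 2 * (A' + 3 * A * √k) * ((1 + |x|) * bump a b k x) *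
        (bump a b k x ^ 2 * invSq a b k x) := by ring
    _ = _ := by rw [h.bump_sq_mul, mul_one]

theorem bump_le_const (h : Admissible a b k) (x : ℝ) : bump a b k x ^ 2 ≤ k / rootDisc a b k := by
  have hD := h.rootDisc_pos
  have hk := h.k_pos
  rw [h.bump_sq]
  refine (h.inv_invSq_le x).trans (div_le_self (by positivity) (Real.one_le_cosh _))

end Admissible

theorem invSq_even (a b k x : ℝ) : invSq a b k (-x) = invSq a b k x := by
  unfold invSq
  rw [mul_neg, Real.cosh_neg]

theorem invSqDk_even (a b k x : ℝ) : invSqDk a b k (-x) = invSqDk a b k x := by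
  unfold invSqDk
  rw [invSq_even, mul_neg, Real.cosh_neg, Real.sinh_neg]
  ring

theorem bump_even (a b k x : ℝ) : bump a b k (-x) = bump a b k x := by
  unfold bump
  rw [invSq_even]

theorem bumpDk_even (a b k x : ℝ) : bumpDk a b k (-x) = bumpDk a b k x := by
  unfold bumpDk
  rw [bump_even, invSqDk_even]

/-! ### Identification of `R_ω` with the closed formula, and the derivative of the charge. -/

theorem admissible_of_mem {a b m ω : ℝ} (ha : 0 < a) (hb : 0 < b)
    (hω : ω ∈ Ioo (omegaStar a b m) m) : Admissible a b (m ^ 2 - ω ^ 2) :=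
  ⟨ha, hb, (_root_.disc_pos ha hb hω).1, (_root_.disc_pos ha hb hω).2⟩

theorem solvesIVP_bump {a b m ω : ℝ} (ha : 0 < a) (hb : 0 < b)
    (hω : ω ∈ Ioo (omegaStar a b m) m) : SolvesIVP a b m ω (bump a b (m ^ 2 - ω ^ 2)) := by
  have h := admissible_of_mem ha hb hω
  have d1 : deriv (bump a b (m ^ 2 - ω ^ 2)) = bumpDx a b (m ^ 2 - ω ^ 2) :=
    funext fun x => (h.hasDerivAt_bump x).deriv
  refine ⟨?_, fun x => ?_, ?_, ?_⟩
  · have h1 : ContDiff ℝ 2 (invSq a b (m ^ 2 - ω ^ 2)) := by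
      unfold invSq
      exact (contDiff_const.add (contDiff_const.mul
        ((contDiff_const.mul contDiff_id).cosh))).div_const _
    exact contDiff_const.div (h1.sqrt fun x => (h.invSq_pos x).ne')
      fun x => (Real.sqrt_pos.2 (h.invSq_pos x)).ne'
  · rw [d1, (h.hasDerivAt_bumpDx x).deriv, (G_hasDerivAt a b _).deriv]
  · rw [d1]
    simp [bumpDx, invSqDx]
  · rw [Rstar_eq ha hb hω]
    simp [bump, invSq, rootDisc]

theorem profile_eq_bump {a b m ω : ℝ} (ha : 0 < a) (hb : 0 < b)
    (hω : ω ∈ Ioo (omegaStar a b m) m) : profile a b m ω = bump a b (m ^ 2 - ω ^ 2) :=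
  solvesIVP_unique (profile_spec ha hb hω) (solvesIVP_bump ha hb hω)

/-- The chain rule for `ω` times the mass at `k = m² - ω²`: the mass has `k`-derivative `2∫ R ∂_k R`
and `dk/dω = -2ω`, whence the factor `-4ω²`. -/
theorem hasDerivAt_chargeMap {a b m ω : ℝ} (ha : 0 < a) (hb : 0 < b)
    (hω : ω ∈ Ioo (omegaStar a b m) m) :
    HasDerivAt (chargeMap a b m) ((∫ x, bump a b (m ^ 2 - ω ^ 2) x ^ 2) -
      4 * ω ^ 2 * ∫ x, bump a b (m ^ 2 - ω ^ 2) x * bumpDk a b (m ^ 2 - ω ^ 2) x) ω := by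
  have h := admissible_of_mem ha hb hω
  have hk : HasDerivAt (fun w : ℝ => m ^ 2 - w ^ 2) (-(2 * ω)) ω := by
    simpa using (hasDerivAt_pow 2 ω).const_sub (m ^ 2)
  have h1 := (hasDerivAt_id ω).mul (h.hasDerivAt_integral_inv_invSq.comp ω hk)
  have e1 : chargeMap a b m =ᶠ[𝓝 ω]
      id * ((fun k => ∫ x, (invSq a b k x)⁻¹) ∘ fun w : ℝ => m ^ 2 - w ^ 2) := by
    filter_upwards [Ioo_mem_nhds hω.1 hω.2] with w hw
    simp only [chargeMap, Pi.mul_apply, id, Function.comp]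
    rw [profile_eq_bump ha hb hw]
    simp only [(admissible_of_mem ha hb hw).bump_sq]
  refine (h1.congr_of_eventuallyEq e1).congr_deriv ?_
  have e2 : ∫ x, -invSqDk a b (m ^ 2 - ω ^ 2) x / invSq a b (m ^ 2 - ω ^ 2) x ^ 2 =
      2 * ∫ x, bump a b (m ^ 2 - ω ^ 2) x * bumpDk a b (m ^ 2 - ω ^ 2) x := by
    rw [← integral_const_mul]
    refine integral_congr_ae (Eventually.of_forall fun x => ?_)
    simp only
    have e3 : bump a b (m ^ 2 - ω ^ 2) x ^ 4 = (invSq a b (m ^ 2 - ω ^ 2) x ^ 2)⁻¹ := by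
      rw [show bump a b (m ^ 2 - ω ^ 2) x ^ 4 = (bump a b (m ^ 2 - ω ^ 2) x ^ 2) ^ 2 by ring,
        h.bump_sq, inv_pow]
    rw [div_eq_mul_inv, ← e3]
    unfold bumpDk
    ring
  rw [e2]
  simp only [id, Function.comp, h.bump_sq]
  ring

/-- The profile as an element of `H¹_r`. -/
def profileH1r {a b k : ℝ} (h : Admissible a b k) : H1r :=
  H1r.ofFun h.hasDerivAt_bump h.memLp_bump h.memLp_bumpDx (bump_even a b k)

/-- The derivative of the profile in the parameter `k` as an element of `H¹_r`. -/
def profileDkH1r {a b k : ℝ} (h : Admissible a b k) : H1r :=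
  H1r.ofFun h.hasDerivAt_bumpDk h.memLp_bumpDk h.memLp_bumpDkDx (bumpDk_even a b k)

theorem val_profileH1r {a b k : ℝ} (h : Admissible a b k) :
    ∀ᵐ x, H1val (profileH1r h) x = bump a b k x :=
  H1r.val_ofFun h.hasDerivAt_bump h.memLp_bump h.memLp_bumpDx (bump_even a b k)

theorem val_profileDkH1r {a b k : ℝ} (h : Admissible a b k) :
    ∀ᵐ x, H1val (profileDkH1r h) x = bumpDk a b k x :=
  H1r.val_ofFun h.hasDerivAt_bumpDk h.memLp_bumpDk h.memLp_bumpDkDx (bumpDk_even a b k)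

theorem grad_profileDkH1r {a b k : ℝ} (h : Admissible a b k) :
    ∀ᵐ x, H1grad (profileDkH1r h) x = bumpDkDx a b k x :=
  H1r.grad_ofFun h.hasDerivAt_bumpDk h.memLp_bumpDk h.memLp_bumpDkDx (bumpDk_even a b k)

/-! ### The linearised operator at `±R_ω`, with the sign recorded by `ε`. -/

section Linearisation

variable {a b m ω ε : ℝ} {u : H1r}

/-- Only even powers of the profile enter the potential, so both signs have the same linearisation.
-/
theorem linPotential_ae (hε : ε ^ 2 = 1)
    (hu : ∀ᵐ x, H1val u x = ε * bump a b (m ^ 2 - ω ^ 2) x) :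
    ∀ᵐ x, linPotential a b m ω (H1val u x) =
      linPotential a b m ω (bump a b (m ^ 2 - ω ^ 2) x) := by
  filter_upwards [hu] with x hx
  rw [hx]
  unfold linPotential
  rw [mul_pow, mul_pow, show ε ^ 4 = (ε ^ 2) ^ 2 by ring, hε]
  ring

theorem linForm_profile_apply (hε : ε ^ 2 = 1)
    (hu : ∀ᵐ x, H1val u x = ε * bump a b (m ^ 2 - ω ^ 2) x) (v w : H1r) :
    linForm a b m ω u v w = (∫ x, H1grad v x * H1grad w x) +
      ∫ x, linPotential a b m ω (bump a b (m ^ 2 - ω ^ 2) x) * H1val v x * H1val w x := by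
  rw [linForm_apply]
  congr 1
  refine integral_congr_ae ?_
  filter_upwards [linPotential_ae hε hu] with x hx
  rw [hx]

theorem continuous_linPotential_bump (h : Admissible a b (m ^ 2 - ω ^ 2)) :
    Continuous fun x => linPotential a b m ω (bump a b (m ^ 2 - ω ^ 2) x) := by
  have hc := h.continuous_bump
  unfold linPotential
  fun_prop

theorem exists_bound_linPotential_bump (h : Admissible a b (m ^ 2 - ω ^ 2)) :
    ∃ B, ∀ x, |linPotential a b m ω (bump a b (m ^ 2 - ω ^ 2) x)| ≤ B := by
  set M := (m ^ 2 - ω ^ 2) / rootDisc a b (m ^ 2 - ω ^ 2)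
  refine ⟨|m ^ 2 - ω ^ 2| + 12 * a * M + 30 * b * M ^ 2, fun x => ?_⟩
  have ha := h.a_pos
  have hb := h.b_pos
  have h1 := h.bump_le_const x
  have h2 := sq_nonneg (bump a b (m ^ 2 - ω ^ 2) x)
  have e : linPotential a b m ω (bump a b (m ^ 2 - ω ^ 2) x) = (m ^ 2 - ω ^ 2) -
      12 * a * bump a b (m ^ 2 - ω ^ 2) x ^ 2 +
      30 * b * (bump a b (m ^ 2 - ω ^ 2) x ^ 2) ^ 2 := by
    unfold linPotential
    ring
  rw [e]
  refine (abs_add_le _ _).trans (add_le_add ((abs_sub _ _).trans (add_le_add le_rfl ?_)) ?_)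
  · rw [abs_of_nonneg (by positivity)]
    gcongr
  · rw [abs_of_nonneg (by positivity)]
    gcongr

/-- The linearised operator has trivial kernel on even functions. -/
theorem linForm_kernel_trivial (h : Admissible a b (m ^ 2 - ω ^ 2)) (hε : ε ^ 2 = 1)
    (hu : ∀ᵐ x, H1val u x = ε * bump a b (m ^ 2 - ω ^ 2) x) (v : H1r)
    (hv : ∀ w, linForm a b m ω u v w = 0) : v = 0 := by
  obtain ⟨B, hB⟩ := exists_bound_linPotential_bump h
  set k := m ^ 2 - ω ^ 2 with hk
  -- Differentiating the profile equation in `x`: `R'` is the odd solution required by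
  -- `even_kernel_trivial`, with `P = R'` and `Q = R''`.
  have dQ : ∀ x, HasDerivAt
      (fun x => -4 * a * bump a b k x ^ 3 + 6 * b * bump a b k x ^ 5 + k * bump a b k x)
      (linPotential a b m ω (bump a b k x) * bumpDx a b k x) x := fun x => by
    have dR := h.hasDerivAt_bump x
    refine ((((dR.pow 3).const_mul (-4 * a)).add ((dR.pow 5).const_mul (6 * b))).add
      (dR.const_mul k)).congr_deriv ?_
    unfold linPotential
    push_cast
    rw [← hk]
    ring
  have cR := h.continuous_bump
  refine even_kernel_trivial (continuous_linPotential_bump h) hB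
    (fun x => by rw [bump_even]) h.hasDerivAt_bumpDx dQ h.memLp_bumpDx ?_ ?_ ?_
    (fun w => by rw [← linForm_profile_apply hε hu]; exact hv w)
  · set M := k / rootDisc a b k
    refine h.memLp_of_abs_le (by fun_prop) (4 * a * M + 6 * b * M ^ 2 + k) fun x => ?_
    have ha := h.a_pos
    have hb := h.b_pos
    have hkp := h.k_pos
    have hR := h.bump_pos x
    have h1 := h.bump_le_const x
    have h2 : |-4 * a * bump a b k x ^ 3 + 6 * b * bump a b k x ^ 5 + k * bump a b k x| ≤
        (4 * a * bump a b k x ^ 2 + 6 * b * (bump a b k x ^ 2) ^ 2 + k) * bump a b k x := by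
      rw [abs_le]
      constructor
      · have : 0 ≤ 12 * b * bump a b k x ^ 5 + 2 * k * bump a b k x := by positivity
        nlinarith
      · have : 0 ≤ 8 * a * bump a b k x ^ 3 := by positivity
        nlinarith
    refine h2.trans ?_
    have h3 := h.bump_le_weight x
    have hM : 0 ≤ M := (sq_nonneg _).trans h1
    gcongr
  · simp [bumpDx, invSqDx]
  -- Since `y'(0) = 0` and `y''(0) = 4D`, one gets `R''(0) = -2 D R(0)³ ≠ 0`.
  · have e := (h.hasDerivAt_invSqDx 0).const_mul (-(1 / 2))
    have h3 := (e.mul ((h.hasDerivAt_bump 0).pow 3)).unique (h.hasDerivAt_bumpDx 0)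
    have hR := h.bump_pos 0
    have hD := h.rootDisc_pos
    rw [← h3, h.k_mul_invSq]
    have h0 : invSqDx a b k 0 = 0 := by simp [invSqDx]
    simp only [h0, mul_zero, Real.cosh_zero, mul_one, zero_mul, add_zero, add_sub_cancel_left,
      Pi.pow_apply]
    have : 0 < rootDisc a b k * bump a b k 0 ^ 3 := by positivity
    intro hz
    nlinarith

/-- Differentiating the profile equation in `k` gives `(∂_k R)'' = q ∂_k R + R`; integration by
parts puts this in weak form. -/
theorem linForm_profileDk (h : Admissible a b (m ^ 2 - ω ^ 2)) (hε : ε ^ 2 = 1)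
    (hu : ∀ᵐ x, H1val u x = ε * bump a b (m ^ 2 - ω ^ 2) x) (w : H1r) :
    linForm a b m ω u (profileDkH1r h) w =
      - ∫ x, bump a b (m ^ 2 - ω ^ 2) x * H1val w x := by
  obtain ⟨B, hB⟩ := exists_bound_linPotential_bump h
  have cq := continuous_linPotential_bump h
  rw [linForm_profile_apply hε hu]
  have m1 := memLp_mul_of_bound cq hB h.memLp_bumpDk
  have hw := H1.memLp_val (w : H1)
  have e0 : ∀ x, (m ^ 2 - ω ^ 2 - 12 * a * bump a b (m ^ 2 - ω ^ 2) x ^ 2 +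
      30 * b * bump a b (m ^ 2 - ω ^ 2) x ^ 4) * bumpDk a b (m ^ 2 - ω ^ 2) x +
      bump a b (m ^ 2 - ω ^ 2) x = linPotential a b m ω (bump a b (m ^ 2 - ω ^ 2) x) *
        bumpDk a b (m ^ 2 - ω ^ 2) x + bump a b (m ^ 2 - ω ^ 2) x := fun x => rfl
  have dT := h.hasDerivAt_bumpDkDx
  simp only [e0] at dT
  have e1 : ∫ x, H1grad (profileDkH1r h) x * H1grad w x =
      ∫ x, bumpDkDx a b (m ^ 2 - ω ^ 2) x * H1grad w x := by
    refine integral_congr_ae ?_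
    filter_upwards [grad_profileDkH1r h] with x hx
    rw [hx]
  have e2 : ∫ x, linPotential a b m ω (bump a b (m ^ 2 - ω ^ 2) x) *
      H1val (profileDkH1r h) x * H1val w x =
      ∫ x, linPotential a b m ω (bump a b (m ^ 2 - ω ^ 2) x) *
        bumpDk a b (m ^ 2 - ω ^ 2) x * H1val w x := by
    refine integral_congr_ae ?_
    filter_upwards [val_profileDkH1r h] with x hx
    rw [hx]
  have i1 : Integrable fun x => linPotential a b m ω (bump a b (m ^ 2 - ω ^ 2) x) *
      bumpDk a b (m ^ 2 - ω ^ 2) x * H1val w x := m1.integrable_mul hw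
  have i2 : Integrable fun x => bump a b (m ^ 2 - ω ^ 2) x * H1val w x :=
    h.memLp_bump.integrable_mul hw
  rw [e1, e2, integral_mul_grad_eq_neg dT h.memLp_bumpDkDx (m1.add h.memLp_bump)]
  simp only [add_mul]
  rw [integral_add i1 i2]
  ring

theorem mass_profile (hε : ε ^ 2 = 1)
    (hu : ∀ᵐ x, H1val u x = ε * bump a b (m ^ 2 - ω ^ 2) x) :
    mass u = ∫ x, bump a b (m ^ 2 - ω ^ 2) x ^ 2 := by
  refine integral_congr_ae ?_
  filter_upwards [hu] with x hx
  rw [hx, mul_pow, hε, one_mul]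

theorem mass_profile_pos (h : Admissible a b (m ^ 2 - ω ^ 2)) (hε : ε ^ 2 = 1)
    (hu : ∀ᵐ x, H1val u x = ε * bump a b (m ^ 2 - ω ^ 2) x) : 0 < mass u := by
  rw [mass_profile hε hu]
  have hpos : ∀ x, 0 < bump a b (m ^ 2 - ω ^ 2) x ^ 2 := fun x => pow_pos (h.bump_pos x) 2
  rw [integral_pos_iff_support_of_nonneg (fun x => (hpos x).le) h.memLp_bump.integrable_sq]
  have hs : Function.support (fun x => bump a b (m ^ 2 - ω ^ 2) x ^ 2) = univ :=
    eq_univ_of_forall fun x => (hpos x).ne'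
  rw [hs]
  simp

theorem profile_nondegenerate_iff (h : Admissible a b (m ^ 2 - ω ^ 2)) (hω : ω ≠ 0)
    (hε : ε ^ 2 = 1) (hu : ∀ᵐ x, H1val u x = ε * bump a b (m ^ 2 - ω ^ 2) x)
    (hmin : IsRadialMinimum a b m (u, ω)) :
    (IsNondegenerate a b m (u, ω) ↔ (∫ x, bump a b (m ^ 2 - ω ^ 2) x ^ 2) -
      4 * ω ^ 2 * (∫ x, bump a b (m ^ 2 - ω ^ 2) x * bumpDk a b (m ^ 2 - ω ^ 2) x) ≠ 0) ∧
    (HasPosDefHessian a b m (u, ω) ↔ (∫ x, bump a b (m ^ 2 - ω ^ 2) x ^ 2) -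
      4 * ω ^ 2 * (∫ x, bump a b (m ^ 2 - ω ^ 2) x * bumpDk a b (m ^ 2 - ω ^ 2) x) ≠ 0) := by
  -- `S = ε ∂_ω R_ω`, since `dk/dω = -2ω`. The linearised operator maps it to `2ωεR = 2ωu`.
  have key := nondegenerate_and_posDef_iff (S := (-(2 * ω * ε)) • profileDkH1r h) hω
    (mass_profile_pos h hε hu) hmin (linForm_kernel_trivial h hε hu) (fun w => by
      rw [map_smul, smul_apply, linForm_profileDk h hε hu, smul_eq_mul, neg_mul_neg,
        mul_assoc (2 * ω), ← integral_const_mul]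
      congr 1
      refine integral_congr_ae ?_
      filter_upwards [hu] with x hx
      rw [hx, mul_assoc])
  have e : mass u + 2 * ω * (∫ x, H1val u x *
      H1val ((-(2 * ω * ε)) • profileDkH1r h : H1r) x) =
      (∫ x, bump a b (m ^ 2 - ω ^ 2) x ^ 2) - 4 * ω ^ 2 *
        ∫ x, bump a b (m ^ 2 - ω ^ 2) x * bumpDk a b (m ^ 2 - ω ^ 2) x := by
    have e1 : ∫ x, H1val u x * H1val ((-(2 * ω * ε)) • profileDkH1r h : H1r) x =
        -(2 * ω) * ∫ x, bump a b (m ^ 2 - ω ^ 2) x * bumpDk a b (m ^ 2 - ω ^ 2) x := by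
      rw [← integral_const_mul]
      refine integral_congr_ae ?_
      have hs : (H1val ((-(2 * ω * ε)) • profileDkH1r h : H1r)) =
        (-(2 * ω * ε)) • H1val (profileDkH1r h) := rfl
      rw [hs]
      filter_upwards [hu, val_profileDkH1r h,
        Lp.coeFn_smul (-(2 * ω * ε)) (H1val (profileDkH1r h))] with x a1 a2 a3
      rw [a3, Pi.smul_apply, a1, a2, smul_eq_mul]
      linear_combination (-2 * ω * bump a b (m ^ 2 - ω ^ 2) x *
        bumpDk a b (m ^ 2 - ω ^ 2) x) * hε
    rw [e1, mass_profile hε hu]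
    ring
  rw [e] at key
  exact key

end Linearisation

end

theorem mainTheorem5 (a b m : ℝ) (ha : 0 < a) (hb : 0 < b) (hm : 0 < m)
    (hτ : 1 < 2 * m ^ 2 * b / a ^ 2) (ω : ℝ) (hω : ω ∈ Set.Ioo (omegaStar a b m) m) :
    ∃ R : H1r, (H1val R : ℝ → ℝ) =ᵐ[MeasureTheory.volume] profile a b m ω ∧
      ∃ σ' : ℝ, HasDerivAt (chargeMap a b m) σ' ω ∧
        ∀ u : H1r, (u = R ∨ u = -R) → IsRadialMinimum a b m (u, ω) →
          (IsNondegenerate a b m (u, ω) ↔ σ' ≠ 0) ∧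
          (HasPosDefHessian a b m (u, ω) ↔ σ' ≠ 0) := by
  have h := admissible_of_mem ha hb hω
  have hω0 : 0 < ω := lt_of_le_of_lt (Real.sqrt_nonneg _) hω.1
  refine ⟨profileH1r h, ?_, _, hasDerivAt_chargeMap ha hb hω, ?_⟩
  · rw [profile_eq_bump ha hb hω]
    exact val_profileH1r h
  · rintro u (rfl | rfl) hmin
    · refine profile_nondegenerate_iff (ε := 1) h hω0.ne' (by norm_num) ?_ hmin
      filter_upwards [val_profileH1r h] with x hx
      rw [hx, one_mul]
    · refine profile_nondegenerate_iff (ε := -1) h hω0.ne' (by norm_num) ?_ hmin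
      have hs : H1val (-profileH1r h : H1r) = -H1val (profileH1r h) := rfl
      rw [hs]
      filter_upwards [val_profileH1r h, Lp.coeFn_neg (H1val (profileH1r h))] with x a1 a2
      rw [a2, Pi.neg_apply, a1, neg_one_mul]
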